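/- All manifolds are connected complete smooth Riemannian manifolds without boundary (Hausdorff, second countable) of the same dimension $n$. An embedded transnormal system of codimension $k$ on such a manifold $M$ is a partition $\mathcal F$ of $M$ into connected embedded submanifolds (the foils), the greatest dimension of a foil being $n-k$, such that every geodesic of $M$ is orthogonal to the foils it meets either at all of its points or at none of them. (The main case is $k=1$.) A regular Riemannian covering $\pi:X\to Y$ is a surjective, locally isometric covering map whose group $G(X,\pi)$ of covering transformations acts transitively on each fibre. A regular covering $\pi:(X,\mathcal G)\to(Y,\mathcal F)$ of manifolds with transnormal systems of codimension $k$ is a regular Riemannian covering $\pi:X\to Y$ such that $\mathcal G$ is the lift of $\mathcal F$, that is, the set of connected components of the preimages $\pi^{-1}(F)$, $F\in\mathcal F$, and such that $\pi$ maps every foil of $\mathcal G$ onto a foil of $\mathcal F$. Proposition. Let $\mathcal F$ be an embedded transnormal system of codimension $k$ on $M$, let $\hat\pi:\hat M\to M$ be a regular Riemannian covering, and let $\hat{\mathcal F}$ be the lift of $\mathcal F$ along $\hat\pi$. Then $\hat{\mathcal F}$ is an embedded transnormal system of codimension $k$ on $\hat M$, $\hat\pi:(\hat M,\hat{\mathcal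 F})\to(M,\mathcal F)$ is a regular covering of manifolds with transnormal systems of codimension $k$, and $\hat\pi=\tilde\pi\circ p$ decomposes into regular coverings of manifolds with transnormal systems of codimension $k$ $$(\hat M,\hat{\mathcal F})\xrightarrow{\;p\;}(\tilde M,\tilde{\mathcal F})\xrightarrow{\;\tilde\pi\;}(M,\mathcal F)$$ such that (C1) $g(\hat F)=\hat F$ for every $g\in G(\hat M,p)$ and every $\hat F\in\hat{\mathcal F}$; (C2) if $\phi\in G(\tilde M,\tilde\pi)$ satisfies $\phi(\tilde F)=\tilde F$ for every $\tilde F\in\tilde{\mathcal F}$, then $\phi$ is the identity. This decomposition is unique: if $(\hat M,\hat{\mathcal F})\xrightarrow{p'}(\tilde M',\tilde{\mathcal F}')\xrightarrow{\tilde\pi'}(M,\mathcal F)$ is another one with these properties, there is exactly one isometric diffeomorphism $\Phi:\tilde M\to\tilde M'$ with $\Phi\circ p=p'$ and $\tilde\pi'\circ\Phi=\tilde\pi$ that maps the foils of $\tilde{\mathcal F}$ to the foils of $\tilde{\mathcal F}'$, that is, $\tilde{\mathcal F}'=\{\Phi(F):F\in\tilde{\mathcal F}\}$. -/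

import Mathlib

open scoped Manifold ContDiff Topology Bundle

universe u v w

namespace Transnormal

/-- A connected complete smooth Riemannian manifold (Hausdorff, second countable, without boundary)
of dimension `n`: a smooth manifold with a smooth Riemannian metric, whose distance is the
infimum of the lengths of curves, and which is complete for this distance. -/
structure RiemannianMfd (n : ℕ) : Type (u + 1) where
  carrier : Type u
  [emetric : EMetricSpace carrier]
  [charted : ChartedSpace (EuclideanSpace ℝ (Fin n)) carrier]
  [smooth : IsManifold (𝓡 n) ∞ carrier]
  [metric : Bundle.RiemannianBundle (fun x : carrier => TangentSpace (𝓡 n) x)]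
  [metric_smooth : IsContMDiffRiemannianBundle (𝓡 n) ∞ (EuclideanSpace ℝ (Fin n))
    (fun x : carrier => TangentSpace (𝓡 n) x)]
  [riemannian : IsRiemannianManifold (𝓡 n) carrier]
  [connected : ConnectedSpace carrier]
  [secondCountable : SecondCountableTopology carrier]
  [complete : CompleteSpace carrier]

instance (n : ℕ) : CoeSort (RiemannianMfd.{u} n) (Type u) := ⟨RiemannianMfd.carrier⟩

attribute [instance] RiemannianMfd.emetric RiemannianMfd.charted RiemannianMfd.smooth
  RiemannianMfd.metric RiemannianMfd.metric_smooth RiemannianMfd.riemannian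
  RiemannianMfd.connected RiemannianMfd.secondCountable RiemannianMfd.complete

variable {n : ℕ}

/-! ### Geodesics, submanifolds, transnormal systems -/

/-- The velocity at time `t` of a curve in `M`. -/
noncomputable def velocity {M : RiemannianMfd.{u} n} (c : ℝ → M) (t : ℝ) :
    TangentSpace (𝓡 n) (c t) :=
  mfderiv 𝓘(ℝ, ℝ) (𝓡 n) c t (1 : ℝ)

/-- A (complete) geodesic: a smooth curve of constant speed that locally realizes the distance. -/
def IsGeodesic {M : RiemannianMfd.{u} n} (γ : ℝ → M) : Prop :=
  ContMDiff 𝓘(ℝ, ℝ) (𝓡 n) ∞ γ ∧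
    ∃ speed : ℝ, 0 ≤ speed ∧ ∀ t : ℝ, ∃ ε > 0, ∀ r s : ℝ, |r - t| < ε → |s - t| < ε →
      edist (γ r) (γ s) = ENNReal.ofReal (speed * |r - s|)

/-- `L` is an embedded submanifold of `M` of dimension `d`: around each of its points there is a
smooth chart of `M` in which `L` is the slice where the coordinates of index `≥ d` vanish. -/
def IsEmbeddedSubmanifold {M : RiemannianMfd.{u} n} (d : ℕ) (L : Set M) : Prop :=
  d ≤ n ∧ ∀ x ∈ L, ∃ φ ∈ IsManifold.maximalAtlas (𝓡 n) ∞ M, x ∈ φ.source ∧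
    ∀ y ∈ φ.source, y ∈ L ↔ ∀ i : Fin n, d ≤ (i : ℕ) → φ y i = 0

/-- The tangent space at `x` of a submanifold `L` through `x`: the velocities at `x` of the smooth
curves in `L` that pass through `x` at time `0`. -/
def tangentTo {M : RiemannianMfd.{u} n} (L : Set M) (x : M) : Set (TangentSpace (𝓡 n) x) :=
  {w | ∃ c : ℝ → M, c 0 = x ∧ ContMDiffAt 𝓘(ℝ, ℝ) (𝓡 n) ∞ c 0 ∧
    (∀ᶠ t in 𝓝 (0 : ℝ), c t ∈ L) ∧ w = velocity c 0}

/-- At time `t`, the curve `γ` is orthogonal to the member of `F` through `γ t`. -/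
def OrthogonalAt {M : RiemannianMfd.{u} n} (F : Set (Set M)) (γ : ℝ → M) (t : ℝ) : Prop :=
  ∀ L ∈ F, γ t ∈ L → ∀ w ∈ tangentTo L (γ t), inner ℝ (velocity γ t) w = 0

/-- `F` is an embedded transnormal system of codimension `k` on `M`: a partition of `M` into
connected embedded submanifolds (the foils), the greatest dimension of a foil being `n - k`, such
that every geodesic is orthogonal to the foils at all or at none of its points. -/
structure IsTransnormalSystem {M : RiemannianMfd.{u} n} (k : ℕ) (F : Set (Set M)) : Prop where
  partition : Setoid.IsPartition F
  connected : ∀ L ∈ F, IsConnected L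
  embedded : ∀ L ∈ F, ∃ d : ℕ, d + k ≤ n ∧ IsEmbeddedSubmanifold d L
  codim : ∃ L ∈ F, ∃ d : ℕ, d + k = n ∧ IsEmbeddedSubmanifold d L
  transnormal : ∀ γ : ℝ → M, IsGeodesic γ →
    (∀ t, OrthogonalAt F γ t) ∨ (∀ t, ¬ OrthogonalAt F γ t)

/-! ### Coverings -/

/-- The covering transformations of `q`: the homeomorphisms `g` with `q ∘ g = q`. -/
def deck {X : Type u} {Y : Type v} [TopologicalSpace X] (q : X → Y) : Set (X ≃ₜ X) :=
  {g | ∀ x, q (g x) = q x}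

/-- `f` is smooth and its differential preserves the Riemannian metrics. -/
def PreservesMetric {X : RiemannianMfd.{u} n} {Y : RiemannianMfd.{v} n} (f : X → Y) : Prop :=
  ContMDiff (𝓡 n) (𝓡 n) ∞ f ∧ ∀ (x : X) (a b : TangentSpace (𝓡 n) x),
    inner ℝ (mfderiv (𝓡 n) (𝓡 n) f x a) (mfderiv (𝓡 n) (𝓡 n) f x b) = inner ℝ a b

/-- A regular Riemannian covering map: a surjective covering map which is locally isometric, and
whose covering transformations act transitively on each fibre. -/
structure IsRegularRiemannianCovering {X : RiemannianMfd.{u} n} {Y : RiemannianMfd.{v} n}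
    (q : X → Y) : Prop where
  covering : IsCoveringMap q
  surjective : Function.Surjective q
  isometric : PreservesMetric q
  regular : ∀ x y : X, q x = q y → ∃ g ∈ deck q, g x = y

/-- The lift of a partition `F` along `q`: the connected components of the preimages of its
members. (If `F` consists of the connected components of the level sets of a function `f`, these
are the connected components of the level sets of `f ∘ q`.) -/
def lift {X : Type u} {Y : Type v} [TopologicalSpace X] (q : X → Y) (F : Set (Set Y)) :
    Set (Set X) :=
  {C | ∃ L ∈ F, ∃ x ∈ q ⁻¹' L, C = connectedComponentIn (q ⁻¹' L) x}

/-- `q : (X, G) → (Y, F)` is a regular Riemannian covering of manifolds with transnormal systems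
of codimension `k`: `G` is the lift of `F`, and every foil of `G` is mapped onto a foil of `F`. -/
structure IsFoilCovering (k : ℕ) {X : RiemannianMfd.{u} n} {Y : RiemannianMfd.{v} n}
    (q : X → Y) (G : Set (Set X)) (F : Set (Set Y)) : Prop where
  covering : IsRegularRiemannianCovering q
  source : IsTransnormalSystem k G
  target : IsTransnormalSystem k F
  lift_eq : G = lift q F
  maps_foils : ∀ L ∈ G, q '' L ∈ F

/-- A decomposition `(X, G) → (mid, midFoils) → (Y, F)` of `q : X → Y` into two regular Riemannian
coverings, such that every covering transformation of the first map fixes every foil, and the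
identity is the only covering transformation of the second map that fixes every foil. -/
structure Decomposition (k : ℕ) {X : RiemannianMfd.{u} n} {Y : RiemannianMfd.{v} n}
    (q : X → Y) (G : Set (Set X)) (F : Set (Set Y)) where
  mid : RiemannianMfd.{w} n
  midFoils : Set (Set mid)
  fst : X → mid
  snd : mid → Y
  fst_covering : IsFoilCovering k fst G midFoils
  snd_covering : IsFoilCovering k snd midFoils F
  comp_eq : snd ∘ fst = q
  fst_fixes : ∀ g ∈ deck fst, ∀ L ∈ G, g '' L = L
  snd_effective : ∀ φ ∈ deck snd, (∀ L ∈ midFoils, φ '' L = L) → φ = Homeomorph.refl mid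

/-- An isomorphism between two decompositions of the same covering: an isometric diffeomorphism
of the middle manifolds that matches both covering maps and the foils. -/
structure IsDecompositionIso {k : ℕ} {X : RiemannianMfd.{u} n} {Y : RiemannianMfd.{v} n}
    {q : X → Y} {G : Set (Set X)} {F : Set (Set Y)}
    (D : Decomposition.{u, v, u} k q G F) (D' : Decomposition.{u, v, w} k q G F)
    (Φ : D.mid ≃ₘ^∞⟮𝓡 n, 𝓡 n⟯ D'.mid) : Prop where
  isometric : PreservesMetric Φ
  fst_comm : ∀ x, Φ (D.fst x) = D'.fst x
  snd_comm : ∀ y, D'.snd (Φ y) = D.snd y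
  foils : (fun L : Set D.mid => Φ '' L) '' D.midFoils = D'.midFoils

end Transnormal

/-!
The decomposition is the quotient by the covering transformations that are invisible to the foils.
Let `K` be the group of covering transformations `g` of `q : X → Y` that map every foil of
`G = lift q F` to itself. Covering transformations permute the foils of `G`, so `K` is normal
(`conj_mem_fixingGroup`), and the middle manifold is the orbit space `X / K`.

That `G` is a transnormal system mapped to `F` by `q` (`IsTransnormalSystem.lift`,
`IsRegularRiemannianCovering.isFoilCovering`) is a local matter, apart from two facts: `q` maps
geodesics to geodesics, because a covering map that preserves the metric is locally an isometry for
the distances (`eventually_edist_map_eq`, by lifting short curves), and `q` maps foils onto foils,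
because a connected embedded submanifold is path connected and paths lift
(`image_connectedComponentIn_eq`).

For the existence, `X → X / K` and `X / K → Y` are topological coverings
(`isCoveringMap_of_fibres_orbits`, applied to `K` and to the covering transformations of the second
map), and `X / K` is Hausdorff (`t2Space_orbitSpace`). The charts and the metric of `X / K` are
pulled back from `Y` along the second map; that is the type synonym `Pullback`, in which tangent
spaces are by definition those of `Y`. It is complete because fast Cauchy sequences lift to `X`
(`completeSpace_of_isCoveringMap`). Every covering transformation of `X → X / K` lies in `K`, as it
agrees with an element of `K` at a point. Conversely a covering transformation `φ` of `X / K → Y`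
lifts to a covering transformation `g` of `q`; if `φ` fixes every foil, then so does `g`, hence `g`
is in `K` and `φ` is the identity (`eq_refl_of_fixes_foils`).

For the uniqueness, the fibres of the first map of any decomposition are the orbits of `K`
(`Decomposition.fst_eq_iff`). So the first maps of two decompositions have the same fibres, and the
bijection of the middle manifolds that they induce is a diffeomorphism and an isometry, since both
maps are local isometries.
-/

namespace Transnormal

/-! ### Local diffeomorphisms -/

section LocalDiffeomorphism

variable {n : ℕ} {X : Type*} {Y : Type*} [TopologicalSpace X] [TopologicalSpace Y]
  [ChartedSpace (EuclideanSpace ℝ (Fin n)) X] [ChartedSpace (EuclideanSpace ℝ (Fin n)) Y]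

/-- A local inverse of a local diffeomorphism `f`, packaged with `f` itself as the forward map. -/
lemma exists_inverse_of_isLocalDiffeomorph {f : X → Y}
    (hf : IsLocalDiffeomorph (𝓡 n) (𝓡 n) ∞ f) (x : X) :
    ∃ e : OpenPartialHomeomorph X Y, x ∈ e.source ∧ f = e ∧
      ContMDiffOn (𝓡 n) (𝓡 n) ∞ e.symm e.target := by
  obtain ⟨Φ, hx, hΦ⟩ := hf x
  refine ⟨{ Φ.toOpenPartialHomeomorph with
    toFun := f
    map_source' := fun y hy => by
      rw [hΦ hy]; exact Φ.map_source hy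
    left_inv' := fun y hy => by
      rw [hΦ hy]; exact Φ.left_inv hy
    right_inv' := fun y hy => by
      exact (hΦ (Φ.map_target hy)).trans (Φ.right_inv hy)
    continuousOn_toFun := Φ.contMDiffOn_toFun.continuousOn.congr hΦ }, hx, rfl, ?_⟩
  exact Φ.contMDiffOn_invFun

/-- The inverse function theorem, for a map that is already known to be a local homeomorphism:
only the smoothness of the local inverses is at stake. -/
lemma isLocalDiffeomorph_of_injective_mfderiv [IsManifold (𝓡 n) ∞ X] [IsManifold (𝓡 n) ∞ Y]
    {f : X → Y} (hf : IsLocalHomeomorph f) (hs : ContMDiff (𝓡 n) (𝓡 n) ∞ f)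
    (hinj : ∀ x, Function.Injective (mfderiv (𝓡 n) (𝓡 n) f x)) :
    IsLocalDiffeomorph (𝓡 n) (𝓡 n) ∞ f := by
  intro x
  obtain ⟨e, hx, rfl⟩ := hf x
  refine ⟨{ e.toPartialEquiv with
    open_source := e.open_source
    open_target := e.open_target
    contMDiffOn_toFun := hs.contMDiffOn
    contMDiffOn_invFun := ?_ }, hx, fun _ _ => rfl⟩
  suffices h : ∀ a ∈ e.source, ContMDiffAt (𝓡 n) (𝓡 n) ∞ e.symm (e a) by
    intro y hy
    have := h (e.symm y) (e.map_target hy)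
    rw [e.right_inv hy] at this
    exact this.contMDiffWithinAt
  intro a ha
  let F : OpenPartialHomeomorph (EuclideanSpace ℝ (Fin n)) (EuclideanSpace ℝ (Fin n)) :=
    (chartAt _ a).symm.trans (e.trans (chartAt _ (e a)))
  have hsm := (contMDiffAt_iff.1 (hs a)).2
  let D : EuclideanSpace ℝ (Fin n) →L[ℝ] EuclideanSpace ℝ (Fin n) := mfderiv (𝓡 n) (𝓡 n) e a
  have hder : HasFDerivAt F D (chartAt (EuclideanSpace ℝ (Fin n)) a a) := by
    have := ((hs a).mdifferentiableAt (by simp)).hasMFDerivAt.2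
    simp only [mfld_simps] at this
    exact this.hasFDerivAt Filter.univ_mem
  simp only [mfld_simps, contDiffWithinAt_univ] at hsm
  let L : EuclideanSpace ℝ (Fin n) ≃L[ℝ] EuclideanSpace ℝ (Fin n) :=
    (LinearEquiv.ofInjectiveEndo D.toLinearMap (hinj a)).toContinuousLinearEquiv
  have hL : (L : EuclideanSpace ℝ (Fin n) →L[ℝ] EuclideanSpace ℝ (Fin n)) = D := by
    ext1 v
    rfl
  have hsymm : F.symm (chartAt _ (e a) (e a)) = chartAt _ a a := by
    simp [F, e.left_inv ha]
  have key : ContDiffAt ℝ ∞ F.symm (chartAt (EuclideanSpace ℝ (Fin n)) (e a) (e a)) := by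
    refine F.contDiffAt_symm (f₀' := L) ?_ ?_ ?_
    · simp [F, e.left_inv ha, e.map_source ha]
    · rw [hsymm, hL]
      exact hder
    · rw [hsymm]
      exact hsm
  rw [contMDiffAt_iff]
  refine ⟨e.continuousAt_symm (e.map_source ha), ?_⟩
  rw [e.left_inv ha]
  simp only [mfld_simps, contDiffWithinAt_univ]
  exact key

end LocalDiffeomorphism

/-! ### Lengths, distances and geodesics under locally isometric coverings -/

section PathLifting

open Manifold Set

variable {n : ℕ} {X : Type*} {Y : Type*} [TopologicalSpace X] [TopologicalSpace Y]
  [ChartedSpace (EuclideanSpace ℝ (Fin n)) X] [ChartedSpace (EuclideanSpace ℝ (Fin n)) Y]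

/-- A continuous lift of a `C^1` curve along a local diffeomorphism is `C^1`. -/
lemma contMDiffOn_of_comp_of_isLocalDiffeomorph {p : X → Y}
    (hp : IsLocalDiffeomorph (𝓡 n) (𝓡 n) ∞ p) {c : ℝ → X} {γ : ℝ → Y} {s : Set ℝ}
    (hc : ContinuousOn c s) (hγ : ContMDiffOn 𝓘(ℝ, ℝ) (𝓡 n) 1 γ s) (h : ∀ t ∈ s, p (c t) = γ t) :
    ContMDiffOn 𝓘(ℝ, ℝ) (𝓡 n) 1 c s := by
  intro t ht
  obtain ⟨e, hte, rfl, he⟩ := exists_inverse_of_isLocalDiffeomorph hp (c t)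
  have h1 : ContMDiffAt (𝓡 n) (𝓡 n) 1 e.symm (γ t) := by
    rw [← h t ht]
    exact ((he.of_le (by simp)) _ (e.map_source hte)).contMDiffAt
      (e.open_target.mem_nhds (e.map_source hte))
  refine (h1.comp_contMDiffWithinAt t (hγ t ht)).congr_of_eventuallyEq ?_ ?_
  · filter_upwards [(hc t ht).preimage_mem_nhdsWithin (e.open_source.mem_nhds hte),
      self_mem_nhdsWithin] with r hr hrs
    simp only [Function.comp_apply, ← h r hrs]
    exact (e.left_inv hr).symm
  · simp only [Function.comp_apply, ← h t ht]
    exact (e.left_inv hte).symm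

variable [Bundle.RiemannianBundle (fun x : X => TangentSpace (𝓡 n) x)]
  [Bundle.RiemannianBundle (fun x : Y => TangentSpace (𝓡 n) x)]

lemma pathELength_comp_of_enorm_mfderiv_eq {p : X → Y} (hp : MDifferentiable (𝓡 n) (𝓡 n) p)
    (hn : ∀ (x : X) (v : TangentSpace (𝓡 n) x), ‖mfderiv (𝓡 n) (𝓡 n) p x v‖ₑ = ‖v‖ₑ)
    {c : ℝ → X} {a b : ℝ} (hab : a < b) (hc : ContMDiffOn 𝓘(ℝ, ℝ) (𝓡 n) 1 c (Icc a b)) :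
    pathELength (𝓡 n) (p ∘ c) a b = pathELength (𝓡 n) c a b := by
  simp only [pathELength_eq_lintegral_mfderivWithin_Icc]
  refine MeasureTheory.setLIntegral_congr_fun measurableSet_Icc fun t ht => ?_
  have := mfderiv_comp_mfderivWithin t (hp (c t)) ((hc t ht).mdifferentiableWithinAt one_ne_zero)
    (uniqueMDiffWithinAt_iff_uniqueDiffWithinAt.2 (uniqueDiffOn_Icc hab t ht))
  simp only [this]
  exact hn (c t) _

/-- Short curves lift to curves of the same length: this is what makes a locally isometric
covering map submetric. -/
lemma exists_lift_riemannianEDist_lt {p : X → Y} (hc : IsCoveringMap p)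
    (hp : IsLocalDiffeomorph (𝓡 n) (𝓡 n) ∞ p)
    (hn : ∀ (x : X) (v : TangentSpace (𝓡 n) x), ‖mfderiv (𝓡 n) (𝓡 n) p x v‖ₑ = ‖v‖ₑ)
    {x : X} {y : Y} {r : ENNReal} (h : riemannianEDist (𝓡 n) (p x) y < r) :
    ∃ x', p x' = y ∧ riemannianEDist (𝓡 n) x x' < r := by
  obtain ⟨γ, h0, h1, hγ, hl, -⟩ := exists_lt_locally_constant_of_riemannianEDist_lt h zero_lt_one
  let γ' : C(unitInterval, Y) := ⟨fun t => γ t, hγ.continuous.comp continuous_subtype_val⟩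
  have hγ0 : γ' 0 = p x := h0
  let Γ := hc.liftPath γ' x hγ0
  have hΓ : ∀ t, p (Γ t) = γ' t := fun t => congr_fun (hc.liftPath_lifts γ' x hγ0) t
  have hΓ0 : Γ 0 = x := hc.liftPath_zero γ' x hγ0
  let c : ℝ → X := fun t => Γ (projIcc 0 1 zero_le_one t)
  have hcc : Continuous c := Γ.continuous.comp continuous_projIcc
  have hpc : ∀ t ∈ Icc (0 : ℝ) 1, p (c t) = γ t := by
    intro t ht
    simp only [c, hΓ, projIcc_of_mem zero_le_one ht]
    rfl
  have hcd := contMDiffOn_of_comp_of_isLocalDiffeomorph hp hcc.continuousOn hγ.contMDiffOn hpc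
  have hc0 : c 0 = x := by simp only [c, projIcc_left]; exact hΓ0
  refine ⟨c 1, by rw [hpc 1 (right_mem_Icc.2 zero_le_one), h1], ?_⟩
  refine (riemannianEDist_le_pathELength hcd hc0 rfl zero_le_one).trans_lt ?_
  rw [← pathELength_comp_of_enorm_mfderiv_eq (hp.mdifferentiable (by simp)) hn zero_lt_one hcd,
    pathELength_congr (γ := p ∘ c) (γ' := γ) (fun t ht => hpc t ht)]
  exact hl

lemma riemannianEDist_map_le {p : X → Y} (hp : ContMDiff (𝓡 n) (𝓡 n) ∞ p)
    (hn : ∀ (x : X) (v : TangentSpace (𝓡 n) x), ‖mfderiv (𝓡 n) (𝓡 n) p x v‖ₑ = ‖v‖ₑ) (x x' : X) :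
    riemannianEDist (𝓡 n) (p x) (p x') ≤ riemannianEDist (𝓡 n) x x' := by
  refine le_of_forall_gt fun r hr => ?_
  obtain ⟨γ, h0, h1, hγ, hl, -⟩ := exists_lt_locally_constant_of_riemannianEDist_lt hr zero_lt_one
  have hpγ : ContMDiffOn 𝓘(ℝ, ℝ) (𝓡 n) 1 (p ∘ γ) (Icc 0 1) :=
    ((hp.of_le (by simp)).comp hγ).contMDiffOn
  refine (riemannianEDist_le_pathELength hpγ (by simp [h0]) (by simp [h1]) zero_le_one).trans_lt ?_
  rwa [pathELength_comp_of_enorm_mfderiv_eq (hp.mdifferentiable (by simp)) hn zero_lt_one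
    hγ.contMDiffOn]

end PathLifting

section Isometry

variable {n : ℕ} {X : RiemannianMfd.{u} n} {Y : RiemannianMfd.{v} n} {q : X → Y}

lemma PreservesMetric.norm_mfderiv (hq : PreservesMetric q) (x : X) (v : TangentSpace (𝓡 n) x) :
    ‖mfderiv (𝓡 n) (𝓡 n) q x v‖ = ‖v‖ := by
  rw [norm_eq_sqrt_real_inner, norm_eq_sqrt_real_inner, hq.2]

lemma PreservesMetric.enorm_mfderiv (hq : PreservesMetric q) (x : X) (v : TangentSpace (𝓡 n) x) :
    ‖mfderiv (𝓡 n) (𝓡 n) q x v‖ₑ = ‖v‖ₑ :=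
  enorm_eq_iff_norm_eq.2 (hq.norm_mfderiv x v)

lemma PreservesMetric.injective_mfderiv (hq : PreservesMetric q) (x : X) :
    Function.Injective (mfderiv (𝓡 n) (𝓡 n) q x) := by
  refine (injective_iff_map_eq_zero _).2 fun v hv => ?_
  rw [← norm_eq_zero, ← hq.norm_mfderiv, hv, norm_zero]

namespace IsRegularRiemannianCovering

lemma isLocalDiffeomorph (hq : IsRegularRiemannianCovering q) :
    IsLocalDiffeomorph (𝓡 n) (𝓡 n) ∞ q :=
  isLocalDiffeomorph_of_injective_mfderiv hq.covering.isLocalHomeomorph hq.isometric.1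
    hq.isometric.injective_mfderiv

lemma edist_map_le (hq : IsRegularRiemannianCovering q) (a b : X) :
    edist (q a) (q b) ≤ edist a b := by
  rw [IsRiemannianManifold.out (I := 𝓡 n), IsRiemannianManifold.out (I := 𝓡 n)]
  exact riemannianEDist_map_le hq.isometric.1 hq.isometric.enorm_mfderiv a b

lemma exists_lift_edist_lt (hq : IsRegularRiemannianCovering q) {a : X} {y : Y} {r : ENNReal}
    (h : edist (q a) y < r) : ∃ b, q b = y ∧ edist a b < r := by
  rw [IsRiemannianManifold.out (I := 𝓡 n)] at h
  obtain ⟨b, hb, hr⟩ := exists_lift_riemannianEDist_lt hq.covering hq.isLocalDiffeomorph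
    hq.isometric.enorm_mfderiv h
  exact ⟨b, hb, by rwa [IsRiemannianManifold.out (I := 𝓡 n)]⟩

/-- A regular Riemannian covering map is locally an isometry for the distances: were the image
distance of two points near `x` smaller, a lifted short curve would end at a second point of the
same fibre close to `x`. -/
lemma eventually_edist_map_eq (hq : IsRegularRiemannianCovering q) (x : X) :
    ∃ U ∈ 𝓝 x, ∀ a ∈ U, ∀ b ∈ U, edist (q a) (q b) = edist a b := by
  obtain ⟨e, hx, rfl⟩ := hq.covering.isLocalHomeomorph x
  obtain ⟨r, hr, hball⟩ := EMetric.mem_nhds_iff.1 (e.open_source.mem_nhds hx)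
  refine ⟨Metric.eball x (r / 3), Metric.eball_mem_nhds x (ENNReal.div_pos hr.ne' (by simp)),
    fun a ha b hb => le_antisymm (hq.edist_map_le a b) ?_⟩
  by_contra! hlt
  obtain ⟨b', hb', hab'⟩ := hq.exists_lift_edist_lt hlt
  have hsub : r / 3 + r / 3 + r / 3 = r := ENNReal.add_thirds r
  have h3 : r / 3 ≤ r := by
    conv_rhs => rw [← hsub]
    exact le_add_self
  have hab : edist a b < r / 3 + r / 3 :=
    (edist_triangle_right a b x).trans_lt (ENNReal.add_lt_add ha hb)
  have hxb' : b' ∈ Metric.eball x r := by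
    rw [Metric.mem_eball, ← hsub]
    calc edist b' x ≤ edist b' a + edist a x := edist_triangle _ _ _
      _ < (r / 3 + r / 3) + r / 3 := ENNReal.add_lt_add (by rw [edist_comm]; exact hab'.trans hab) ha
  have : b' = b := e.injOn (hball hxb') (hball (Metric.eball_subset_eball h3 hb)) hb'
  exact (this ▸ hab').false

lemma isGeodesic_comp (hq : IsRegularRiemannianCovering q) {γ : ℝ → X} (hγ : IsGeodesic γ) :
    IsGeodesic (q ∘ γ) := by
  obtain ⟨hs, speed, h0, hloc⟩ := hγ
  refine ⟨hq.isometric.1.comp hs, speed, h0, fun t => ?_⟩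
  obtain ⟨ε, hε, h⟩ := hloc t
  obtain ⟨U, hU, hUe⟩ := hq.eventually_edist_map_eq (γ t)
  obtain ⟨δ, hδ, hδU⟩ := Metric.mem_nhds_iff.1 (hs.continuous.continuousAt.preimage_mem_nhds hU)
  refine ⟨min ε δ, lt_min hε hδ, fun r s hr hs' => ?_⟩
  have hmem : ∀ {r}, |r - t| < min ε δ → γ r ∈ U := fun {r} hr =>
    hδU (by rw [Metric.mem_ball, Real.dist_eq]; exact hr.trans_le (min_le_right _ _))
  rw [← h r s (hr.trans_le (min_le_left _ _)) (hs'.trans_le (min_le_left _ _))]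
  exact hUe _ (hmem hr) _ (hmem hs')

end IsRegularRiemannianCovering

end Isometry

/-! ### Lifts of transnormal systems -/

section Submanifold

variable {n : ℕ} {X : RiemannianMfd.{u} n} {Y : RiemannianMfd.{v} n} {q : X → Y}

lemma _root_.JoinedIn.mem_connectedComponentIn {Z : Type*} [TopologicalSpace Z] {S : Set Z}
    {x y : Z} (h : JoinedIn S x y) : y ∈ connectedComponentIn S x := by
  obtain ⟨γ, hγ⟩ := h
  exact (isPreconnected_range γ.continuous).subset_connectedComponentIn ⟨0, γ.source⟩
    (Set.range_subset_iff.2 hγ) ⟨1, γ.target⟩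

/-- Slice charts of an embedded submanifold can be chosen such that the slice lies in one path
component of the submanifold: restrict to a ball in the coordinates. -/
lemma IsEmbeddedSubmanifold.exists_chart_joinedIn {d : ℕ} {S : Set X}
    (hS : IsEmbeddedSubmanifold d S) {x : X} (hx : x ∈ S) :
    ∃ φ ∈ IsManifold.maximalAtlas (𝓡 n) ∞ X, x ∈ φ.source ∧
      (∀ y ∈ φ.source, y ∈ S ↔ ∀ i : Fin n, d ≤ (i : ℕ) → φ y i = 0) ∧
      ∀ y ∈ φ.source, y ∈ S → JoinedIn S x y := by
  obtain ⟨φ, hφ, hxφ, h⟩ := hS.2 x hx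
  obtain ⟨r, hr, hball⟩ := Metric.isOpen_iff.1 φ.open_target _ (φ.map_source hxφ)
  have hopen : IsOpen (φ.source ∩ φ ⁻¹' Metric.ball (φ x) r) :=
    φ.isOpen_inter_preimage Metric.isOpen_ball
  have hsource : (φ.restr (φ.source ∩ φ ⁻¹' Metric.ball (φ x) r)).source =
      φ.source ∩ φ ⁻¹' Metric.ball (φ x) r := by
    rw [φ.restr_source, hopen.interior_eq, ← Set.inter_assoc, Set.inter_self]
  refine ⟨φ.restr (φ.source ∩ φ ⁻¹' Metric.ball (φ x) r),
    restr_mem_maximalAtlas _ hφ hopen, ?_, ?_, ?_⟩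
  · rw [hsource]
    exact ⟨hxφ, Metric.mem_ball_self hr⟩
  · intro y hy
    rw [hsource] at hy
    exact h y hy.1
  · intro y hy hyS
    rw [hsource] at hy
    have hseg : segment ℝ (φ x) (φ y) ⊆ Metric.ball (φ x) r :=
      (convex_ball _ _).segment_subset (Metric.mem_ball_self hr) hy.2
    have hj : JoinedIn (segment ℝ (φ x) (φ y)) (φ x) (φ y) :=
      JoinedIn.of_segment_subset subset_rfl
    have hj' := hj.map_continuousOn (φ.continuousOn_symm.mono (hseg.trans hball))
    rw [φ.left_inv hxφ, φ.left_inv hy.1] at hj'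
    refine hj'.mono ?_
    rintro _ ⟨z, hz, rfl⟩
    refine (h _ (φ.map_target (hball (hseg hz)))).2 fun i hi => ?_
    rw [φ.right_inv (hball (hseg hz))]
    obtain ⟨a, b, -, -, -, rfl⟩ := hz
    simp [(h x hxφ).1 hx i hi, (h y hy.1).1 hyS i hi]

/-- A connected embedded submanifold is path connected. -/
lemma IsEmbeddedSubmanifold.joinedIn {d : ℕ} {S : Set X} (hS : IsEmbeddedSubmanifold d S)
    (hc : IsConnected S) {x y : X} (hx : x ∈ S) (hy : y ∈ S) : JoinedIn S x y := by
  refine hc.isPreconnected.induction₂ (JoinedIn S) (fun x hx => ?_)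
    (fun _ _ _ _ _ _ h h' => h.trans h') (fun _ _ _ _ h => h.symm) hx hy
  obtain ⟨φ, -, hxφ, -, h⟩ := hS.exists_chart_joinedIn hx
  filter_upwards [mem_nhdsWithin_of_mem_nhds (φ.open_source.mem_nhds hxφ), self_mem_nhdsWithin]
    with y hy hyS using h y hy hyS

lemma IsEmbeddedSubmanifold.connectedComponentIn {d : ℕ} {S : Set X}
    (hS : IsEmbeddedSubmanifold d S) (x : X) :
    IsEmbeddedSubmanifold d (connectedComponentIn S x) := by
  refine ⟨hS.1, fun y hy => ?_⟩
  obtain ⟨φ, hφ, hyφ, h, hj⟩ := hS.exists_chart_joinedIn (connectedComponentIn_subset S x hy)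
  refine ⟨φ, hφ, hyφ, fun z hz => ?_⟩
  rw [← h z hz, connectedComponentIn_eq hy]
  exact ⟨fun hz' => connectedComponentIn_subset S y hz',
    fun hz' => (hj z hz hz').mem_connectedComponentIn⟩

lemma IsEmbeddedSubmanifold.preimage {d : ℕ} {L : Set Y} (hL : IsEmbeddedSubmanifold d L)
    (hq : IsLocalDiffeomorph (𝓡 n) (𝓡 n) ∞ q) : IsEmbeddedSubmanifold d (q ⁻¹' L) := by
  refine ⟨hL.1, fun x hx => ?_⟩
  obtain ⟨φ, hφ, hxφ, h⟩ := hL.2 (q x) hx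
  have hs := hq.contMDiff
  obtain ⟨e, hxe, rfl, he⟩ := exists_inverse_of_isLocalDiffeomorph hq x
  refine ⟨e.trans φ, OpenPartialHomeomorph.mem_maximalAtlas_of_contMDiffOn _ ?_ ?_, ?_, ?_⟩
  · exact (contMDiffOn_of_mem_maximalAtlas hφ).comp hs.contMDiffOn fun y hy => hy.2
  · exact he.comp ((contMDiffOn_symm_of_mem_maximalAtlas hφ).mono fun y hy => hy.1)
      fun y hy => hy.2
  · exact ⟨hxe, hxφ⟩
  · intro y hy
    exact h (e y) hy.2

end Submanifold

section Lift

variable {X : Type u} {Y : Type v} [TopologicalSpace X] {q : X → Y} {F : Set (Set Y)}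

lemma exists_of_mem_lift {C : Set X} (hC : C ∈ lift q F) {x : X} (hx : x ∈ C) :
    ∃ L ∈ F, q x ∈ L ∧ C = connectedComponentIn (q ⁻¹' L) x := by
  obtain ⟨L, hL, y, hy, rfl⟩ := hC
  exact ⟨L, hL, connectedComponentIn_subset (q ⁻¹' L) y hx, connectedComponentIn_eq hx⟩

lemma isPartition_lift (hF : Setoid.IsPartition F) : Setoid.IsPartition (lift q F) := by
  refine ⟨?_, fun x => ?_⟩
  · rintro ⟨L, hL, x, hx, h⟩
    exact (connectedComponentIn_nonempty_iff.2 hx).ne_empty h.symm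
  · obtain ⟨L, ⟨hL, hx⟩, hu⟩ := hF.2 (q x)
    refine ⟨connectedComponentIn (q ⁻¹' L) x, ⟨⟨L, hL, x, hx, rfl⟩, mem_connectedComponentIn hx⟩, ?_⟩
    rintro C ⟨hC, hxC⟩
    obtain ⟨L', hL', hx', rfl⟩ := exists_of_mem_lift hC hxC
    rw [hu L' ⟨hL', hx'⟩]

lemma eq_of_mem_partition {Z : Type*} {c : Set (Set Z)} (hc : Setoid.IsPartition c) {A B : Set Z}
    (hA : A ∈ c) (hB : B ∈ c) {x : Z} (hxA : x ∈ A) (hxB : x ∈ B) : A = B :=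
  (hc.2 x).unique ⟨hA, hxA⟩ ⟨hB, hxB⟩

/-- Lifting along `p` and then along `r` is the same as lifting along the composition. -/
lemma lift_lift {Z : Type w} [TopologicalSpace Z] {p : X → Z} {r : Z → Y} (hp : Continuous p) :
    lift p (lift r F) = lift (r ∘ p) F := by
  have key : ∀ L : Set Y, ∀ x : X, r (p x) ∈ L →
      connectedComponentIn (p ⁻¹' connectedComponentIn (r ⁻¹' L) (p x)) x =
        connectedComponentIn (r ∘ p ⁻¹' L) x := by
    intro L x hx
    refine (connectedComponentIn_mono x ?_).antisymm ?_
    · exact fun y hy => connectedComponentIn_subset (r ⁻¹' L) (p x) hy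
    · refine isPreconnected_connectedComponentIn.subset_connectedComponentIn
        (mem_connectedComponentIn hx) ?_
      rw [← Set.image_subset_iff]
      refine (isPreconnected_connectedComponentIn.image p
        hp.continuousOn).subset_connectedComponentIn ⟨x, mem_connectedComponentIn hx, rfl⟩ ?_
      rintro _ ⟨y, hy, rfl⟩
      exact connectedComponentIn_subset (r ∘ p ⁻¹' L) x hy
  ext C
  constructor
  · rintro ⟨D, hD, x, hx, rfl⟩
    obtain ⟨L, hL, hxL, rfl⟩ := exists_of_mem_lift hD hx
    exact ⟨L, hL, x, hxL, key L x hxL⟩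
  · rintro ⟨L, hL, x, hx, rfl⟩
    exact ⟨_, ⟨L, hL, p x, hx, rfl⟩, x, mem_connectedComponentIn hx, (key L x hx).symm⟩

end Lift

section FoilCovering

variable {n k : ℕ} {X : RiemannianMfd.{u} n} {Y : RiemannianMfd.{v} n} {q : X → Y}
  {F : Set (Set Y)}

lemma mfderiv_mem_tangentTo (hq : ContMDiff (𝓡 n) (𝓡 n) ∞ q) {L : Set Y} {C : Set X}
    (h : Set.MapsTo q C L) {x : X} {v : TangentSpace (𝓡 n) x} (hv : v ∈ tangentTo C x) :
    mfderiv (𝓡 n) (𝓡 n) q x v ∈ tangentTo L (q x) := by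
  obtain ⟨c, rfl, hc, hC, rfl⟩ := hv
  refine ⟨q ∘ c, rfl, (hq.contMDiffAt).comp 0 hc, hC.mono fun t ht => h ht, ?_⟩
  rw [velocity, velocity, mfderiv_comp 0 (hq.mdifferentiableAt (by simp))
    (hc.mdifferentiableAt (by simp))]
  rfl

/-- Tangent vectors to `L` lift to tangent vectors to the component of the preimage of `L`, since
the curves representing them lift along a local inverse. -/
lemma exists_mem_tangentTo_connectedComponentIn (hq : IsLocalDiffeomorph (𝓡 n) (𝓡 n) ∞ q)
    {L : Set Y} {x : X} {v : TangentSpace (𝓡 n) (q x)} (hv : v ∈ tangentTo L (q x)) :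
    ∃ v' ∈ tangentTo (connectedComponentIn (q ⁻¹' L) x) x, mfderiv (𝓡 n) (𝓡 n) q x v' = v := by
  obtain ⟨c, hc0, hc, hL, rfl⟩ := hv
  have hs := hq.contMDiff
  obtain ⟨e, hxe, rfl, he⟩ := exists_inverse_of_isLocalDiffeomorph hq x
  have hsymm : ContMDiffAt (𝓡 n) (𝓡 n) ∞ e.symm (c 0) := by
    rw [hc0]
    exact (he _ (e.map_source hxe)).contMDiffAt (e.open_target.mem_nhds (e.map_source hxe))
  have hx : (e.symm ∘ c) 0 = x := by
    rw [Function.comp_apply, hc0, e.left_inv hxe]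
  have hcs : ContMDiffAt 𝓘(ℝ, ℝ) (𝓡 n) ∞ (e.symm ∘ c) 0 := hsymm.comp 0 hc
  have htarget : ∀ᶠ t in 𝓝 (0 : ℝ), c t ∈ e.target :=
    hc.continuousAt.preimage_mem_nhds
      (e.open_target.mem_nhds (hc0 ▸ e.map_source hxe))
  refine ⟨velocity (e.symm ∘ c) 0, ⟨e.symm ∘ c, hx, hcs, ?_, rfl⟩, ?_⟩
  · have hcont : ∀ᶠ t in 𝓝 (0 : ℝ), ContinuousAt (e.symm ∘ c) t := by
      have hc1 : ContMDiffAt 𝓘(ℝ, ℝ) (𝓡 n) 1 (e.symm ∘ c) 0 := hcs.of_le (by simp)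
      filter_upwards [(contMDiffAt_iff_contMDiffAt_nhds (by simp)).1 hc1] with t ht
        using ht.continuousAt
    obtain ⟨ε, hε, hball⟩ := Metric.eventually_nhds_iff_ball.1 (hcont.and (htarget.and hL))
    filter_upwards [Metric.ball_mem_nhds (0 : ℝ) hε] with t ht
    have hpre : IsPreconnected ((e.symm ∘ c) '' Metric.ball 0 ε) :=
      (convex_ball _ _).isPreconnected.image _ fun s hs => (hball s hs).1.continuousWithinAt
    refine hpre.subset_connectedComponentIn ⟨0, Metric.mem_ball_self hε, hx⟩ ?_ ⟨t, ht, rfl⟩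
    rintro _ ⟨s, hs, rfl⟩
    rw [Set.mem_preimage, Function.comp_apply, e.right_inv (hball s hs).2.1]
    exact (hball s hs).2.2
  · have hcomp : velocity (e ∘ (e.symm ∘ c)) 0 =
        mfderiv (𝓡 n) (𝓡 n) e ((e.symm ∘ c) 0) (velocity (e.symm ∘ c) 0) := by
      rw [velocity, mfderiv_comp 0 (hs.mdifferentiableAt (by simp))
        (hcs.mdifferentiableAt (by simp))]
      rfl
    have heq : e ∘ (e.symm ∘ c) =ᶠ[𝓝 0] c := by
      filter_upwards [htarget] with t ht using e.right_inv ht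
    have hvel : velocity c 0 = velocity (e ∘ (e.symm ∘ c)) 0 := by
      rw [velocity, velocity, heq.mfderiv_eq]
      rfl
    subst hx
    exact hcomp.symm.trans hvel.symm

lemma orthogonalAt_lift_iff (hq : IsRegularRiemannianCovering q) {γ : ℝ → X} {t : ℝ}
    (hγ : MDifferentiableAt 𝓘(ℝ, ℝ) (𝓡 n) γ t) :
    OrthogonalAt (lift q F) γ t ↔ OrthogonalAt F (q ∘ γ) t := by
  have hvel : velocity (q ∘ γ) t = mfderiv (𝓡 n) (𝓡 n) q (γ t) (velocity γ t) := by
    rw [velocity, mfderiv_comp t (hq.isometric.1.mdifferentiableAt (by simp)) hγ]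
    rfl
  constructor
  · intro h L hL hγL w hw
    obtain ⟨w', hw', rfl⟩ := exists_mem_tangentTo_connectedComponentIn hq.isLocalDiffeomorph hw
    rw [hvel]
    exact (hq.isometric.2 _ _ _).trans
      (h _ ⟨L, hL, γ t, hγL, rfl⟩ (mem_connectedComponentIn hγL) w' hw')
  · intro h C hC hγC w hw
    obtain ⟨L, hL, hγL, rfl⟩ := exists_of_mem_lift hC hγC
    have := h L hL hγL _ (mfderiv_mem_tangentTo hq.isometric.1
      (connectedComponentIn_subset (q ⁻¹' L) (γ t)) hw)
    rw [hvel] at this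
    exact (hq.isometric.2 _ _ _).symm.trans this

/-- Paths in a foil lift to its preimage, so each component of the preimage is mapped onto the
foil. -/
lemma image_connectedComponentIn_eq (hq : IsCoveringMap q) {d : ℕ} {L : Set Y}
    (hL : IsEmbeddedSubmanifold d L) (hc : IsConnected L) {x : X} (hx : q x ∈ L) :
    q '' connectedComponentIn (q ⁻¹' L) x = L := by
  refine (Set.image_subset_iff.2 (connectedComponentIn_subset _ _)).antisymm fun y hy => ?_
  obtain ⟨γ, hγ⟩ := hL.joinedIn hc hx hy
  have h0 : γ.toContinuousMap 0 = q x := γ.source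
  have hlift : ∀ t, q (hq.liftPath γ.toContinuousMap x h0 t) = γ t :=
    fun t => congr_fun (hq.liftPath_lifts γ.toContinuousMap x h0) t
  refine ⟨hq.liftPath γ.toContinuousMap x h0 1, ?_, (hlift 1).trans γ.target⟩
  refine (isPreconnected_range (hq.liftPath γ.toContinuousMap x h0).continuous
    ).subset_connectedComponentIn ⟨0, hq.liftPath_zero _ _ _⟩ ?_ ⟨1, rfl⟩
  rintro _ ⟨t, rfl⟩
  rw [Set.mem_preimage, hlift]
  exact hγ t

lemma IsTransnormalSystem.lift (hF : IsTransnormalSystem k F)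
    (hq : IsRegularRiemannianCovering q) : IsTransnormalSystem k (lift q F) where
  partition := isPartition_lift hF.partition
  connected := by
    rintro _ ⟨L, hL, x, hx, rfl⟩
    exact ⟨⟨x, mem_connectedComponentIn hx⟩, isPreconnected_connectedComponentIn⟩
  embedded := by
    rintro _ ⟨L, hL, x, hx, rfl⟩
    obtain ⟨d, hd, hLd⟩ := hF.embedded L hL
    exact ⟨d, hd, (hLd.preimage hq.isLocalDiffeomorph).connectedComponentIn x⟩
  codim := by
    obtain ⟨L, hL, d, hd, hLd⟩ := hF.codim
    obtain ⟨y, hy⟩ := Setoid.nonempty_of_mem_partition hF.partition hL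
    obtain ⟨x, rfl⟩ := hq.surjective y
    exact ⟨_, ⟨L, hL, x, hy, rfl⟩, d, hd,
      (hLd.preimage hq.isLocalDiffeomorph).connectedComponentIn x⟩
  transnormal := by
    intro γ hγ
    have hd : ∀ t, MDifferentiableAt 𝓘(ℝ, ℝ) (𝓡 n) γ t := fun t =>
      hγ.1.mdifferentiableAt (by simp)
    simp only [fun t => orthogonalAt_lift_iff (F := F) hq (hd t)]
    exact hF.transnormal _ (hq.isGeodesic_comp hγ)

/-- A regular Riemannian covering of a manifold with a transnormal system is a foil covering for
the lifted transnormal system. -/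
theorem IsRegularRiemannianCovering.isFoilCovering (hq : IsRegularRiemannianCovering q)
    (hF : IsTransnormalSystem k F) : IsFoilCovering k q (Transnormal.lift q F) F where
  covering := hq
  source := hF.lift hq
  target := hF
  lift_eq := rfl
  maps_foils := by
    rintro _ ⟨L, hL, x, hx, rfl⟩
    obtain ⟨d, -, hd⟩ := hF.embedded L hL
    rwa [image_connectedComponentIn_eq hq.covering hd (hF.connected L hL) hx]

end FoilCovering

/-! ### Uniqueness of the decomposition -/

section Uniqueness

variable {n : ℕ}

lemma contMDiff_of_comp_isLocalDiffeomorph {X A B : Type*} [TopologicalSpace X]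
    [TopologicalSpace A] [TopologicalSpace B] [ChartedSpace (EuclideanSpace ℝ (Fin n)) X]
    [ChartedSpace (EuclideanSpace ℝ (Fin n)) A] [ChartedSpace (EuclideanSpace ℝ (Fin n)) B]
    {p : X → A} {f : A → B} (hp : IsLocalDiffeomorph (𝓡 n) (𝓡 n) ∞ p)
    (hsurj : Function.Surjective p) (hf : ContMDiff (𝓡 n) (𝓡 n) ∞ (f ∘ p)) :
    ContMDiff (𝓡 n) (𝓡 n) ∞ f := by
  intro a
  obtain ⟨x, rfl⟩ := hsurj a
  obtain ⟨e, hxe, rfl, he⟩ := exists_inverse_of_isLocalDiffeomorph hp x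
  have hsymm : ContMDiffAt (𝓡 n) (𝓡 n) ∞ e.symm (e x) :=
    (he _ (e.map_source hxe)).contMDiffAt (e.open_target.mem_nhds (e.map_source hxe))
  refine (hf.contMDiffAt.comp (e x) hsymm).congr_of_eventuallyEq ?_
  filter_upwards [e.open_target.mem_nhds (e.map_source hxe)] with b hb
  simp only [Function.comp_apply, e.right_inv hb]

/-- Two regular Riemannian coverings with the same fibres have isomorphic targets. -/
lemma exists_diffeomorph_of_fibres_eq {X : RiemannianMfd.{u} n} {A : RiemannianMfd.{v} n}
    {B : RiemannianMfd.{w} n} {p : X → A} {p' : X → B} (hp : IsRegularRiemannianCovering p)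
    (hp' : IsRegularRiemannianCovering p') (h : ∀ x y, p x = p y ↔ p' x = p' y) :
    ∃ Φ : A ≃ₘ^∞⟮𝓡 n, 𝓡 n⟯ B, PreservesMetric Φ ∧ ∀ x, Φ (p x) = p' x := by
  have h1 : ∀ x, p' (Function.surjInv hp.surjective (p x)) = p' x := fun x =>
    (h _ _).1 (Function.surjInv_eq hp.surjective (p x))
  have h2 : ∀ x, p (Function.surjInv hp'.surjective (p' x)) = p x := fun x =>
    (h _ _).2 (Function.surjInv_eq hp'.surjective (p' x))
  let Φ : A ≃ₘ^∞⟮𝓡 n, 𝓡 n⟯ B :=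
    { toFun := p' ∘ Function.surjInv hp.surjective
      invFun := p ∘ Function.surjInv hp'.surjective
      left_inv := fun a => by
        simp only [Function.comp_apply, h2, Function.surjInv_eq]
      right_inv := fun b => by
        simp only [Function.comp_apply, h1, Function.surjInv_eq]
      contMDiff_toFun := by
        refine contMDiff_of_comp_isLocalDiffeomorph hp.isLocalDiffeomorph hp.surjective ?_
        convert hp'.isometric.1 using 1
        exact funext h1
      contMDiff_invFun := by
        refine contMDiff_of_comp_isLocalDiffeomorph hp'.isLocalDiffeomorph hp'.surjective ?_
        convert hp.isometric.1 using 1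
        exact funext h2 }
  have hΦ : ∀ x, Φ (p x) = p' x := h1
  clear_value Φ
  clear h1 h2
  obtain rfl : Φ ∘ p = p' := funext hΦ
  refine ⟨Φ, ⟨Φ.contMDiff, fun a v w => ?_⟩, hΦ⟩
  obtain ⟨x, rfl⟩ := hp.surjective a
  have hcomp : mfderiv (𝓡 n) (𝓡 n) (Φ ∘ p) x =
      (mfderiv (𝓡 n) (𝓡 n) Φ (p x)).comp (mfderiv (𝓡 n) (𝓡 n) p x) :=
    mfderiv_comp x (Φ.contMDiff.mdifferentiableAt (by simp))
      (hp.isometric.1.mdifferentiableAt (by simp))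
  have hsurj : Function.Surjective (mfderiv (𝓡 n) (𝓡 n) p x) :=
    ((hp.isLocalDiffeomorph x).mfderivToContinuousLinearEquiv (by simp)).surjective
  obtain ⟨v, rfl⟩ := hsurj v
  obtain ⟨w, rfl⟩ := hsurj w
  rw [hp.isometric.2, ← hp'.isometric.2 x v w, hcomp]
  rfl

variable {k : ℕ} {X : RiemannianMfd.{u} n} {Y : RiemannianMfd.{v} n} {q : X → Y}
  {G : Set (Set X)} {F : Set (Set Y)}

lemma IsFoilCovering.exists_image_eq {p : X → Y} (hp : IsFoilCovering k p G F) {L : Set Y}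
    (hL : L ∈ F) : ∃ C ∈ G, p '' C = L := by
  obtain ⟨y, hy⟩ := Setoid.nonempty_of_mem_partition hp.target.partition hL
  obtain ⟨x, rfl⟩ := hp.covering.surjective y
  obtain ⟨C, ⟨hC, hx⟩, -⟩ := hp.source.partition.2 x
  exact ⟨C, hC, eq_of_mem_partition hp.target.partition (hp.maps_foils C hC) hL ⟨x, hx, rfl⟩ hy⟩

lemma IsFoilCovering.foils_eq {p : X → Y} (hp : IsFoilCovering k p G F) :
    F = (fun C => p '' C) '' G := by
  ext L
  constructor
  · exact fun hL => hp.exists_image_eq hL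
  · rintro ⟨C, hC, rfl⟩
    exact hp.maps_foils C hC

/-- The fibres of the first map of a decomposition are determined by the covering and its foils:
they are the orbits of the covering transformations that fix every foil. A transformation `g` of
this kind descends to the covering transformation of the second map that takes the image of a point
`x` to the image of `g x`; it fixes every foil, so it is the identity. -/
lemma Decomposition.fst_eq_iff (D : Decomposition.{u, v, w} k q G F) (x y : X) :
    D.fst x = D.fst y ↔ ∃ g ∈ deck q, (∀ L ∈ G, g '' L = L) ∧ g x = y := by
  have hq : ∀ z, q z = D.snd (D.fst z) := fun z => (congr_fun D.comp_eq z).symm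
  constructor
  · intro h
    obtain ⟨g, hg, rfl⟩ := D.fst_covering.covering.regular x y h
    exact ⟨g, fun z => by rw [hq, hq, hg z], D.fst_fixes g hg, rfl⟩
  · rintro ⟨g, hg, hfix, rfl⟩
    obtain ⟨φ, hφ, hφx⟩ := D.snd_covering.covering.regular (D.fst x) (D.fst (g x))
      (by rw [← hq, ← hq, hg x])
    have hcomm : φ ∘ D.fst = D.fst ∘ g := by
      refine D.snd_covering.covering.covering.eq_of_comp_eq
        (φ.continuous.comp D.fst_covering.covering.covering.continuous)
        (D.fst_covering.covering.covering.continuous.comp g.continuous) ?_ x hφx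
      funext z
      simp only [Function.comp_apply]
      rw [hφ (D.fst z), ← hq, ← hq, hg z]
    have hid : φ = Homeomorph.refl D.mid := by
      refine D.snd_effective φ hφ fun L hL => ?_
      obtain ⟨C, hC, rfl⟩ := D.fst_covering.exists_image_eq hL
      rw [← Set.image_comp, hcomm, Set.image_comp, hfix C hC]
    rw [← hφx, hid]
    rfl

theorem Decomposition.existsUnique_iso (D : Decomposition.{u, v, u} k q G F)
    (D' : Decomposition.{u, v, w} k q G F) :
    ∃! Φ : D.mid ≃ₘ^∞⟮𝓡 n, 𝓡 n⟯ D'.mid, IsDecompositionIso D D' Φ := by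
  obtain ⟨Φ, hΦ, hcomm⟩ := exists_diffeomorph_of_fibres_eq D.fst_covering.covering
    D'.fst_covering.covering fun x y => by rw [D.fst_eq_iff, D'.fst_eq_iff]
  refine ⟨Φ, ⟨hΦ, hcomm, fun y => ?_, ?_⟩, fun Ψ hΨ => ?_⟩
  · obtain ⟨x, rfl⟩ := D.fst_covering.covering.surjective y
    rw [hcomm]
    exact (congr_fun D'.comp_eq x).trans (congr_fun D.comp_eq x).symm
  · rw [D.fst_covering.foils_eq, D'.fst_covering.foils_eq, Set.image_image]
    refine Set.image_congr fun C _ => ?_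
    rw [Set.image_image]
    exact Set.image_congr fun x _ => hcomm x
  · ext y
    obtain ⟨x, rfl⟩ := D.fst_covering.covering.surjective y
    rw [hcomm, hΨ.fst_comm]

end Uniqueness

/-! ### The smooth and Riemannian structure pulled back along a local homeomorphism -/

open Manifold

section Pullback

variable {n : ℕ} {Z : Type*} {M : Type*} [TopologicalSpace Z] [TopologicalSpace M] {f : Z → M}

/-- The source of a local homeomorphism `f : Z → M` into a manifold, as a type of its own that
carries the smooth and the Riemannian structure pulled back along `f`. -/
def Pullback (_ : IsLocalHomeomorph f) : Type _ := Z

namespace Pullback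

variable (hf : IsLocalHomeomorph f)

instance : TopologicalSpace (Pullback hf) := inferInstanceAs (TopologicalSpace Z)

/-- The map `f` itself, as a map on the type synonym. -/
def proj : Pullback hf → M := f

/-- The restriction of `f` to a neighbourhood of `z` on which it is a homeomorphism onto an open
set. -/
noncomputable def sheet (z : Pullback hf) : OpenPartialHomeomorph (Pullback hf) M :=
  (hf z).choose

lemma mem_sheet_source (z : Pullback hf) : z ∈ (sheet hf z).source := (hf z).choose_spec.1

lemma coe_sheet (z : Pullback hf) : ⇑(sheet hf z) = proj hf := (hf z).choose_spec.2.symm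

variable [ChartedSpace (EuclideanSpace ℝ (Fin n)) M]

/-- The chart at `z` is `f` near `z` followed by the chart of `M` at `f z`. With this choice, the
tangent space at `z` is the tangent space at `f z`, and the differential of `f` is the identity. -/
noncomputable instance : ChartedSpace (EuclideanSpace ℝ (Fin n)) (Pullback hf) where
  atlas := Set.range fun z => (sheet hf z).trans (chartAt _ (proj hf z))
  chartAt z := (sheet hf z).trans (chartAt _ (proj hf z))
  mem_chart_source z := by
    refine ⟨mem_sheet_source hf z, ?_⟩
    rw [OpenPartialHomeomorph.symm_symm, Set.mem_preimage, coe_sheet]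
    exact mem_chart_source _ _
  chart_mem_atlas z := ⟨z, rfl⟩

lemma chartAt_eq (z : Pullback hf) : chartAt (EuclideanSpace ℝ (Fin n)) z =
    (sheet hf z).trans (chartAt _ (proj hf z)) := rfl

lemma chartAt_apply (z y : Pullback hf) : chartAt (EuclideanSpace ℝ (Fin n)) z y =
    chartAt (EuclideanSpace ℝ (Fin n)) (proj hf z) (proj hf y) := by
  rw [chartAt_eq, OpenPartialHomeomorph.trans_apply, coe_sheet]

lemma proj_chartAt_symm (z : Pullback hf) {y : EuclideanSpace ℝ (Fin n)}
    (hy : y ∈ (chartAt (EuclideanSpace ℝ (Fin n)) z).target) :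
    proj hf ((chartAt (EuclideanSpace ℝ (Fin n)) z).symm y) =
      (chartAt (EuclideanSpace ℝ (Fin n)) (proj hf z)).symm y := by
  conv_lhs => rw [← coe_sheet hf z]
  exact (sheet hf z).right_inv hy.2

lemma proj_mem_chart_source {z y : Pullback hf}
    (hy : y ∈ (chartAt (EuclideanSpace ℝ (Fin n)) z).source) :
    proj hf y ∈ (chartAt (EuclideanSpace ℝ (Fin n)) (proj hf z)).source := by
  have h := hy.2
  rwa [OpenPartialHomeomorph.symm_symm, Set.mem_preimage, coe_sheet] at h

lemma chartAt_target_subset (z : Pullback hf) : (chartAt (EuclideanSpace ℝ (Fin n)) z).target ⊆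
    (chartAt (EuclideanSpace ℝ (Fin n)) (proj hf z)).target := fun _ hy => hy.1

instance [IsManifold (𝓡 n) ∞ M] : IsManifold (𝓡 n) ∞ (Pullback hf) := by
  refine isManifold_of_contDiffOn _ _ _ ?_
  rintro _ _ ⟨z, rfl⟩ ⟨z', rfl⟩
  have h := (contDiffGroupoid ∞ (𝓡 n)).compatible
    (chart_mem_atlas (EuclideanSpace ℝ (Fin n)) (proj hf z))
    (chart_mem_atlas (EuclideanSpace ℝ (Fin n)) (proj hf z'))
  rw [contDiffGroupoid, mem_groupoid_of_pregroupoid] at h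
  replace h := h.1
  simp only [contDiffPregroupoid, mfld_simps] at h
  simp only [← chartAt_eq, mfld_simps]
  refine (h.mono fun y hy => ⟨hy.1.1, ?_⟩).congr fun y hy => ?_
  · rw [Set.mem_preimage, ← proj_chartAt_symm hf z ⟨hy.1.1, hy.1.2⟩]
    exact proj_mem_chart_source hf ⟨hy.2.1, hy.2.2⟩
  · simp only [Function.comp_apply]
    rw [chartAt_apply, proj_chartAt_symm hf z ⟨hy.1.1, hy.1.2⟩]

lemma chartAt_comp_proj_eventuallyEq (z : Pullback hf) :
    chartAt (EuclideanSpace ℝ (Fin n)) (proj hf z) ∘ proj hf ∘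
      (chartAt (EuclideanSpace ℝ (Fin n)) z).symm
      =ᶠ[𝓝 (chartAt (EuclideanSpace ℝ (Fin n)) z z)] id := by
  filter_upwards [chart_target_mem_nhds (EuclideanSpace ℝ (Fin n)) z] with y hy
  simp only [Function.comp_apply, proj_chartAt_symm hf z hy]
  exact (chartAt _ _).right_inv (chartAt_target_subset hf z hy)

lemma continuous_proj : Continuous (proj hf) := hf.continuous

lemma contMDiff_proj : ContMDiff (𝓡 n) (𝓡 n) ∞ (proj hf) := by
  intro z
  rw [contMDiffAt_iff]
  refine ⟨(continuous_proj hf).continuousAt, ?_⟩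
  simp only [mfld_simps, contDiffWithinAt_univ]
  exact contDiffAt_id.congr_of_eventuallyEq (chartAt_comp_proj_eventuallyEq hf z)

lemma hasMFDerivAt_proj (z : Pullback hf) :
    HasMFDerivAt (𝓡 n) (𝓡 n) (proj hf) z (ContinuousLinearMap.id ℝ (EuclideanSpace ℝ (Fin n))) := by
  refine ⟨(continuous_proj hf).continuousAt, ?_⟩
  simp only [mfld_simps]
  exact ((hasFDerivAt_id _).congr_of_eventuallyEq
    (chartAt_comp_proj_eventuallyEq hf z)).hasFDerivWithinAt

lemma mfderiv_proj_apply (z : Pullback hf) (v : TangentSpace (𝓡 n) z) :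
    mfderiv (𝓡 n) (𝓡 n) (proj hf) z v = v := by
  rw [(hasMFDerivAt_proj hf z).mfderiv]
  rfl

lemma isLocalDiffeomorph_proj [IsManifold (𝓡 n) ∞ M] :
    IsLocalDiffeomorph (𝓡 n) (𝓡 n) ∞ (proj hf) := by
  refine isLocalDiffeomorph_of_injective_mfderiv hf (contMDiff_proj hf) fun z => ?_
  rw [(hasMFDerivAt_proj hf z).mfderiv]
  exact Function.injective_id

lemma coordChange_eq [IsManifold (𝓡 n) ∞ M] {z y : Pullback hf}
    (hy : y ∈ (chartAt (EuclideanSpace ℝ (Fin n)) z).source) :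
    (tangentBundleCore (𝓡 n) (Pullback hf)).coordChange (achart _ z) (achart _ y) y =
    (tangentBundleCore (𝓡 n) M).coordChange (achart _ (proj hf z)) (achart _ (proj hf y))
      (proj hf y) := by
  rw [tangentBundleCore_coordChange, tangentBundleCore_coordChange]
  simp only [mfld_simps, fderivWithin_univ, chartAt_apply]
  refine Filter.EventuallyEq.fderiv_eq ?_
  rw [← chartAt_apply]
  filter_upwards [(chartAt (EuclideanSpace ℝ (Fin n)) z).open_target.mem_nhds
    ((chartAt (EuclideanSpace ℝ (Fin n)) z).map_source hy)] with u hu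
  simp only [Function.comp_apply, chartAt_apply, proj_chartAt_symm hf z hu]

section Metric

open Bundle

variable [IsManifold (𝓡 n) ∞ M] [RiemannianBundle (fun x : M => TangentSpace (𝓡 n) x)]

/-- The metric at `z` is the metric of `M` at `f z`. -/
noncomputable instance : RiemannianBundle (fun z : Pullback hf => TangentSpace (𝓡 n) z) where
  g :=
    { inner := fun z => RiemannianBundle.g.inner (E := fun x : M => TangentSpace (𝓡 n) x) (proj hf z)
      symm := fun z => RiemannianBundle.g.symm (E := fun x : M => TangentSpace (𝓡 n) x) (proj hf z)
      pos := fun z => RiemannianBundle.g.pos (E := fun x : M => TangentSpace (𝓡 n) x) (proj hf z)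
      continuousAt := fun z =>
        RiemannianBundle.g.continuousAt (E := fun x : M => TangentSpace (𝓡 n) x) (proj hf z)
      isVonNBounded := fun z =>
        RiemannianBundle.g.isVonNBounded (E := fun x : M => TangentSpace (𝓡 n) x) (proj hf z) }

instance [h : IsContMDiffRiemannianBundle (𝓡 n) ∞ (EuclideanSpace ℝ (Fin n))
    (fun x : M => TangentSpace (𝓡 n) x)] :
    IsContMDiffRiemannianBundle (𝓡 n) ∞ (EuclideanSpace ℝ (Fin n))
    (fun z : Pullback hf => TangentSpace (𝓡 n) z) := by
  obtain ⟨g, hg, hgi⟩ := h.exists_contMDiff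
  refine ⟨fun z => g (proj hf z), fun z => ?_, fun z v w => hgi (proj hf z) v w⟩
  have hM := (hg.comp (contMDiff_proj hf)) z
  rw [contMDiffAt_hom_bundle] at hM ⊢
  refine ⟨contMDiffAt_id, hM.2.congr_of_eventuallyEq ?_⟩
  filter_upwards [chart_source_mem_nhds (EuclideanSpace ℝ (Fin n)) z] with y hy
  have hy' := proj_mem_chart_source hf hy
  ext v w
  have hcoord : ∀ v : EuclideanSpace ℝ (Fin n),
      (trivializationAt (EuclideanSpace ℝ (Fin n)) (TangentSpace (𝓡 n)) z).symm y v =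
      (trivializationAt (EuclideanSpace ℝ (Fin n)) (TangentSpace (𝓡 n)) (proj hf z)).symm
        (proj hf y) v := by
    intro v
    rw [← Trivialization.symmL_apply (R := ℝ) _ (by simpa using hy),
      ← Trivialization.symmL_apply (R := ℝ) _ (by simpa using hy'),
      TangentBundle.symmL_trivializationAt_eq_core hy,
      TangentBundle.symmL_trivializationAt_eq_core hy', coordChange_eq hf hy]
    rfl
  refine (inCoordinates_apply_eq₂ (by simpa using hy) (by simpa using hy)
    (Set.mem_univ _)).trans ?_
  refine Eq.trans ?_ (inCoordinates_apply_eq₂ (x₀ := proj hf z) (x := proj hf y)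
    (by simpa using hy') (by simpa using hy') (Set.mem_univ _)).symm
  rw [hcoord, hcoord]
  rfl

end Metric

end Pullback

end Pullback

/-! ### Completeness and the pulled back distance -/

section Complete

variable {n : ℕ} {X : Type*} {Y : Type*} [EMetricSpace X] [EMetricSpace Y]
  [ChartedSpace (EuclideanSpace ℝ (Fin n)) X] [ChartedSpace (EuclideanSpace ℝ (Fin n)) Y]
  [Bundle.RiemannianBundle (fun x : X => TangentSpace (𝓡 n) x)]
  [Bundle.RiemannianBundle (fun x : Y => TangentSpace (𝓡 n) x)]
  [IsRiemannianManifold (𝓡 n) X] [IsRiemannianManifold (𝓡 n) Y]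

/-- The target of a locally isometric covering map with complete source is complete: a fast Cauchy
sequence lifts to one. -/
lemma completeSpace_of_isCoveringMap [CompleteSpace X] {p : X → Y} (hc : IsCoveringMap p)
    (hsurj : Function.Surjective p) (hp : IsLocalDiffeomorph (𝓡 n) (𝓡 n) ∞ p)
    (hn : ∀ (x : X) (v : TangentSpace (𝓡 n) x), ‖mfderiv (𝓡 n) (𝓡 n) p x v‖ₑ = ‖v‖ₑ) :
    CompleteSpace Y := by
  refine EMetric.complete_of_convergent_controlled_sequences (fun k => 1 / 2 ^ k)
    (fun k => ENNReal.div_pos one_ne_zero (by simp)) fun u hu => ?_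
  have hstep : ∀ (k : ℕ) (x : X), p x = u k →
      ∃ x', p x' = u (k + 1) ∧ edist x x' < 1 / 2 ^ k := by
    intro k x hx
    have h := hu k k (k + 1) le_rfl (Nat.le_succ k)
    rw [← hx, IsRiemannianManifold.out (I := 𝓡 n)] at h
    obtain ⟨x', hx', hd⟩ := exists_lift_riemannianEDist_lt hc hp hn h
    exact ⟨x', hx', by rwa [IsRiemannianManifold.out (I := 𝓡 n)]⟩
  choose! s hs hd using hstep
  obtain ⟨x₀, hx₀⟩ := hsurj (u 0)
  let x : ℕ → X := fun k => Nat.rec x₀ s k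
  have hx : ∀ k, p (x k) = u k := by
    intro k
    induction k with
    | zero => exact hx₀
    | succ k ih => exact hs k (x k) ih
  have hcauchy : CauchySeq x :=
    cauchySeq_of_edist_le_geometric_two 1 (by simp) fun k => (hd k (x k) (hx k)).le
  obtain ⟨a, ha⟩ := cauchySeq_tendsto_of_complete hcauchy
  refine ⟨p a, ?_⟩
  have := (hc.continuous.tendsto a).comp ha
  rwa [show p ∘ x = u from funext hx] at this

end Complete

namespace Pullback

variable {n : ℕ} {Z : Type u} {M : RiemannianMfd.{v} n} [TopologicalSpace Z] {f : Z → M}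
  (hf : IsLocalHomeomorph f)

instance [T2Space Z] : T2Space (Pullback hf) := inferInstanceAs (T2Space Z)

instance [ConnectedSpace Z] : ConnectedSpace (Pullback hf) := inferInstanceAs (ConnectedSpace Z)

instance [SecondCountableTopology Z] : SecondCountableTopology (Pullback hf) :=
  inferInstanceAs (SecondCountableTopology Z)

instance [T2Space Z] : T3Space (Pullback hf) :=
  have : LocallyCompactSpace (Pullback hf) :=
    Manifold.locallyCompact_of_finiteDimensional (𝓡 n)
  inferInstance

instance : IsContinuousRiemannianBundle (EuclideanSpace ℝ (Fin n))
    (fun z : Pullback hf => TangentSpace (𝓡 n) z) := by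
  obtain ⟨g, hg, hgi⟩ := IsContMDiffRiemannianBundle.exists_contMDiff (IB := 𝓡 n) (n := ∞)
    (F := EuclideanSpace ℝ (Fin n)) (E := fun z : Pullback hf => TangentSpace (𝓡 n) z)
  exact ⟨g, hg.continuous, hgi⟩

noncomputable instance [T2Space Z] : EMetricSpace (Pullback hf) :=
  EMetricSpace.ofRiemannianMetric (𝓡 n) (Pullback hf)

instance [T2Space Z] : IsRiemannianManifold (𝓡 n) (Pullback hf) := ⟨fun _ _ => rfl⟩

/-- The source of a local homeomorphism into a Riemannian manifold, with the pulled back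
Riemannian metric. Completeness is not automatic. -/
noncomputable def toRiemannianMfd [T2Space Z] [ConnectedSpace Z] [SecondCountableTopology Z]
    [CompleteSpace (Pullback hf)] : RiemannianMfd.{u} n where
  carrier := Pullback hf

lemma enorm_mfderiv_proj (z : Pullback hf) (v : TangentSpace (𝓡 n) z) :
    ‖mfderiv (𝓡 n) (𝓡 n) (proj hf) z v‖ₑ = ‖v‖ₑ := by
  rw [mfderiv_proj_apply]
  rfl

end Pullback

/-! ### Orbit spaces of groups of covering transformations -/

section Quotient

variable {X : Type u} {Y : Type v} [TopologicalSpace X] {q : X → Y}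

/-- The quotient by a group of covering transformations of a separated locally injective map `q` is
a covering map: a transformation that does not displace an open set on which `q` is injective has a
fixed point in it, so it is the identity. -/
lemma isCoveringMap_of_fibres_orbits {B : Type w} [TopologicalSpace B] [PreconnectedSpace X]
    {f : X → B} (hf : Topology.IsQuotientMap f) (K : Subgroup (X ≃ₜ X))
    (hK : ∀ x y, f x = f y ↔ ∃ g ∈ K, g y = x) (hs : ∀ g ∈ K, g ∈ deck q)
    (hsep : IsSeparatedMap q) (hinj : IsLocallyInjective q) : IsCoveringMap f := by
  let _ : MulAction K X :=
    { smul := fun g x => g.1 x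
      one_smul := fun _ => rfl
      mul_smul := fun _ _ _ => rfl }
  have hquot : IsQuotientCoveringMap f K :=
    { hf with
      continuous_const_smul := fun g => g.1.continuous
      apply_eq_iff_mem_orbit := by
        intro x y
        rw [hK]
        exact ⟨fun ⟨g, hg, h⟩ => ⟨⟨g, hg⟩, h⟩, fun ⟨g, h⟩ => ⟨g.1, g.2, h⟩⟩
      disjoint := by
        intro x
        obtain ⟨U, hU, hx, hUi⟩ := hinj x
        refine ⟨U, hU.mem_nhds hx, ?_⟩
        rintro ⟨g, hg⟩ ⟨_, ⟨y, hy, rfl⟩, hgy⟩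
        have hfix : g y = y := hUi hgy hy (hs g hg y)
        have hid : (g : X → X) = id := hsep.eq_of_comp_eq hinj g.continuous continuous_id
          (funext (hs g hg)) y hfix
        exact Subtype.ext (Homeomorph.ext fun z => congr_fun hid z) }
  exact hquot.isCoveringMap

/-- The covering transformations of a map, as a group. -/
def deckGroup (q : X → Y) : Subgroup (X ≃ₜ X) where
  carrier := deck q
  one_mem' := fun _ => rfl
  mul_mem' := fun {g h} hg hh x => (hg (h x)).trans (hh x)
  inv_mem' := fun {g} hg x => by
    have := hg (g⁻¹ x)
    rw [← this]
    exact congrArg q (g.apply_symm_apply x)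

/-- The covering transformations that map every member of `G` to itself. -/
def fixingGroup (q : X → Y) (G : Set (Set X)) : Subgroup (X ≃ₜ X) where
  carrier := {g | g ∈ deck q ∧ ∀ C ∈ G, g '' C = C}
  one_mem' := ⟨fun _ => rfl, fun C _ => Set.image_id C⟩
  mul_mem' := fun {g h} hg hh => ⟨(deckGroup q).mul_mem hg.1 hh.1, fun C hC => by
    have : ⇑(g * h) = g ∘ h := rfl
    rw [this, Set.image_comp, hh.2 C hC, hg.2 C hC]⟩
  inv_mem' := fun {g} hg => ⟨(deckGroup q).inv_mem hg.1, fun C hC => by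
    conv_lhs => rw [← hg.2 C hC]
    rw [← Set.image_comp]
    have : ⇑g⁻¹ ∘ g = id := funext g.symm_apply_apply
    rw [this, Set.image_id]⟩

/-- Covering transformations permute the components of preimages. -/
lemma image_mem_lift {F : Set (Set Y)} {g : X ≃ₜ X} (hg : g ∈ deck q) {C : Set X}
    (hC : C ∈ lift q F) : g '' C ∈ lift q F := by
  obtain ⟨L, hL, x, hx, rfl⟩ := hC
  refine ⟨L, hL, g x, by rwa [Set.mem_preimage, hg x], ?_⟩
  rw [g.image_connectedComponentIn hx]
  congr 1
  ext y
  rw [g.image_eq_preimage_symm]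
  exact Iff.of_eq (congrArg (· ∈ L) ((deckGroup q).inv_mem hg y))

lemma conj_mem_fixingGroup {F : Set (Set Y)} {g h : X ≃ₜ X} (hg : g ∈ deck q)
    (hh : h ∈ fixingGroup q (lift q F)) : g * h * g⁻¹ ∈ fixingGroup q (lift q F) := by
  have hg' : g⁻¹ ∈ deck q := (deckGroup q).inv_mem hg
  refine ⟨(deckGroup q).mul_mem ((deckGroup q).mul_mem hg hh.1) hg', fun C hC => ?_⟩
  have h1 : ⇑(g * h * g⁻¹) = g ∘ (h ∘ ⇑g⁻¹) := rfl
  rw [h1, Set.image_comp, Set.image_comp, hh.2 _ (image_mem_lift hg' hC), ← Set.image_comp]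
  have : g ∘ ⇑g⁻¹ = id := funext g.apply_symm_apply
  rw [this, Set.image_id]

/-- Points are equivalent if they are in the same orbit of `K`. -/
def orbitSetoid (K : Subgroup (X ≃ₜ X)) : Setoid X where
  r x y := ∃ g ∈ K, g y = x
  iseqv :=
    { refl := fun _ => ⟨1, K.one_mem, rfl⟩
      symm := fun {_ y} ⟨g, hg, h⟩ => ⟨g⁻¹, K.inv_mem hg, by rw [← h]; exact g.symm_apply_apply y⟩
      trans := fun {_ _ _} ⟨g, hg, h⟩ ⟨g', hg', h'⟩ => ⟨g * g', K.mul_mem hg hg', by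
        rw [← h, ← h']; rfl⟩ }

section

variable (K : Subgroup (X ≃ₜ X))

/-- The orbit space of a group of homeomorphisms. -/
abbrev OrbitSpace : Type u := Quotient (orbitSetoid K)

/-- The projection to the orbit space. -/
def toOrbit (x : X) : OrbitSpace K := Quotient.mk (orbitSetoid K) x

lemma toOrbit_eq_iff (x y : X) : toOrbit K x = toOrbit K y ↔ ∃ g ∈ K, g y = x := Quotient.eq

lemma surjective_toOrbit : Function.Surjective (toOrbit K) := Quotient.mk_surjective

lemma isQuotientMap_toOrbit : Topology.IsQuotientMap (toOrbit K) := isQuotientMap_quotient_mk'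

lemma continuous_toOrbit : Continuous (toOrbit K) := (isQuotientMap_toOrbit K).continuous

/-- The map induced on the orbit space by a map that is constant on the orbits. -/
def ofOrbit {K : Subgroup (X ≃ₜ X)} (hK : K ≤ deckGroup q) : OrbitSpace K → Y :=
  Quotient.lift q fun _ y ⟨g, hg, h⟩ => by rw [← h]; exact hK hg y

end

variable {K : Subgroup (X ≃ₜ X)}

/-- Covering transformations that normalize `K` descend to the orbit space. -/
lemma exists_deck_ofOrbit (hK : K ≤ deckGroup q) {g : X ≃ₜ X} (hg : g ∈ deck q)
    (hn : ∀ h ∈ K, g * h * g⁻¹ ∈ K) (hn' : ∀ h ∈ K, g⁻¹ * h * g ∈ K) :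
    ∃ φ ∈ deck (ofOrbit hK), ∀ x, φ (toOrbit K x) = toOrbit K (g x) := by
  have key : ∀ g : X ≃ₜ X, (∀ h ∈ K, g * h * g⁻¹ ∈ K) → ∀ x y, (∃ h ∈ K, h y = x) →
      ∃ h ∈ K, h (g y) = g x := by
    rintro g hn _ y ⟨h, hh, rfl⟩
    refine ⟨g * h * g⁻¹, hn h hh, ?_⟩
    exact congrArg (fun z => g (h z)) (g.symm_apply_apply y)
  have hn'' : ∀ h ∈ K, g⁻¹ * h * g⁻¹⁻¹ ∈ K := by simpa using hn'
  let φ : OrbitSpace K ≃ₜ OrbitSpace K :=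
    { toFun := Quotient.map g (key g hn)
      invFun := Quotient.map ⇑g⁻¹ (key g⁻¹ hn'')
      left_inv := by
        rintro ⟨x⟩
        exact congrArg (toOrbit K) (g.symm_apply_apply x)
      right_inv := by
        rintro ⟨x⟩
        exact congrArg (toOrbit K) (g.apply_symm_apply x)
      continuous_toFun := ((continuous_toOrbit K).comp g.continuous).quotient_lift _
      continuous_invFun := ((continuous_toOrbit K).comp (g⁻¹).continuous).quotient_lift _ }
  refine ⟨φ, ?_, fun _ => rfl⟩
  rintro ⟨x⟩
  exact hg x

lemma exists_deck_ofOrbit_of_eq (hK : K ≤ deckGroup q)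
    (hreg : ∀ x y : X, q x = q y → ∃ g ∈ deck q, g x = y)
    (hnorm : ∀ g ∈ deck q, ∀ h ∈ K, g * h * g⁻¹ ∈ K) {z z' : OrbitSpace K}
    (h : ofOrbit hK z = ofOrbit hK z') :
    ∃ φ ∈ deck (ofOrbit hK), φ z = z' := by
  obtain ⟨x, rfl⟩ := surjective_toOrbit K z
  obtain ⟨x', rfl⟩ := surjective_toOrbit K z'
  obtain ⟨g, hg, rfl⟩ := hreg x x' h
  obtain ⟨φ, hφ, hφg⟩ := exists_deck_ofOrbit hK hg (hnorm g hg) fun h hh => by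
    simpa using hnorm g⁻¹ ((deckGroup q).inv_mem hg) h hh
  exact ⟨φ, hφ, hφg x⟩

variable [TopologicalSpace Y] [PreconnectedSpace X]

lemma eq_of_mem_deck (hq : IsCoveringMap q) {g h : X ≃ₜ X} (hg : g ∈ deck q) (hh : h ∈ deck q)
    {x : X} (hx : g x = h x) : g = h :=
  Homeomorph.ext (congr_fun (hq.eq_of_comp_eq g.continuous h.continuous
    (funext fun y => (hg y).trans (hh y).symm) x hx))

lemma isCoveringMap_toOrbit (hK : K ≤ deckGroup q) (hq : IsCoveringMap q) :
    IsCoveringMap (toOrbit K) :=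
  isCoveringMap_of_fibres_orbits (isQuotientMap_toOrbit K) K (toOrbit_eq_iff K) (fun _ hg => hK hg)
    hq.isSeparatedMap hq.isLocalHomeomorph.isLocallyInjective

lemma isLocalHomeomorph_ofOrbit (hK : K ≤ deckGroup q) (hq : IsCoveringMap q) :
    IsLocalHomeomorph (ofOrbit hK) := by
  rw [isLocalHomeomorph_iff_isLocalHomeomorphOn_univ, ← (surjective_toOrbit K).range_eq,
    ← Set.image_univ]
  refine IsLocalHomeomorphOn.of_comp_right ?_
    (isCoveringMap_toOrbit hK hq).isLocalHomeomorph.isLocalHomeomorphOn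
  exact hq.isLocalHomeomorph.isLocalHomeomorphOn

/-- Orbit spaces of groups of covering transformations are Hausdorff: in a fibre of `q`, the sheets
through different orbits have disjoint images, as the transformations act freely. -/
lemma t2Space_orbitSpace [T2Space Y] (hK : K ≤ deckGroup q) (hq : IsCoveringMap q)
    (hreg : ∀ x y : X, q x = q y → ∃ g ∈ deck q, g x = y) : T2Space (OrbitSpace K) := by
  refine ⟨fun z z' hne => ?_⟩
  obtain ⟨x, rfl⟩ := surjective_toOrbit K z
  obtain ⟨x', rfl⟩ := surjective_toOrbit K z'
  have hcont := (isLocalHomeomorph_ofOrbit hK hq).continuous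
  have hopen := (isCoveringMap_toOrbit hK hq).isOpenMap
  by_cases hxx : q x = q x'
  · obtain ⟨g, hg, rfl⟩ := hreg x x' hxx
    obtain ⟨U, hU, hx, hUi⟩ := hq.isLocalHomeomorph.isLocallyInjective x
    refine ⟨toOrbit K '' U, toOrbit K '' (g '' U), hopen _ hU,
      hopen _ (g.isOpenMap _ hU), ⟨x, hx, rfl⟩, ⟨g x, ⟨x, hx, rfl⟩, rfl⟩, ?_⟩
    rw [Set.disjoint_left]
    rintro _ ⟨y, hy, rfl⟩ ⟨_, ⟨y', hy', rfl⟩, hyy⟩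
    obtain ⟨h, hh, hhy⟩ := (toOrbit_eq_iff K _ _).1 hyy
    have heq : y = y' := hUi hy hy' (by rw [← hK hh y, hhy, hg y'])
    have hgh : h = g := eq_of_mem_deck hq (hK hh) hg (x := y) (by rw [hhy, heq])
    exact hne ((toOrbit_eq_iff K _ _).2 ⟨h⁻¹, K.inv_mem hh, by
      rw [hgh]; exact g.symm_apply_apply x⟩)
  · obtain ⟨U, V, hU, hV, hxU, hxV, hUV⟩ := t2_separation hxx
    exact ⟨ofOrbit hK ⁻¹' U, ofOrbit hK ⁻¹' V, hU.preimage hcont, hV.preimage hcont, hxU, hxV,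
      hUV.preimage _⟩

lemma isCoveringMap_ofOrbit [T2Space Y] (hK : K ≤ deckGroup q) (hq : IsCoveringMap q)
    (hreg : ∀ x y : X, q x = q y → ∃ g ∈ deck q, g x = y)
    (hnorm : ∀ g ∈ deck q, ∀ h ∈ K, g * h * g⁻¹ ∈ K) (hsurj : Function.Surjective q) :
    IsCoveringMap (ofOrbit hK) := by
  have := t2Space_orbitSpace hK hq hreg
  have hloc := isLocalHomeomorph_ofOrbit hK hq
  have hs : Function.Surjective (ofOrbit hK) := fun y =>
    let ⟨x, hx⟩ := hsurj y
    ⟨toOrbit K x, hx⟩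
  have : PreconnectedSpace (OrbitSpace K) := ⟨by
    rw [← (surjective_toOrbit K).range_eq]
    exact isPreconnected_range (continuous_toOrbit K)⟩
  refine isCoveringMap_of_fibres_orbits (hloc.isOpenMap.isQuotientMap hloc.continuous hs)
    (deckGroup (ofOrbit hK)) (fun z z' => ⟨fun h => ?_, ?_⟩) (fun _ h => h)
    (T2Space.isSeparatedMap _) hloc.isLocallyInjective
  · exact exists_deck_ofOrbit_of_eq hK hreg hnorm h.symm
  · rintro ⟨φ, hφ, rfl⟩
    exact hφ z'

end Quotient

/-! ### Factorization of regular Riemannian coverings -/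

/-- A continuous lift of a smooth map along a local diffeomorphism is smooth. -/
lemma contMDiff_of_isLocalDiffeomorph_comp {n : ℕ} {X A B : Type*} [TopologicalSpace X]
    [TopologicalSpace A] [TopologicalSpace B] [ChartedSpace (EuclideanSpace ℝ (Fin n)) X]
    [ChartedSpace (EuclideanSpace ℝ (Fin n)) A] [ChartedSpace (EuclideanSpace ℝ (Fin n)) B]
    {p : X → A} {f : A → B} (hf : IsLocalDiffeomorph (𝓡 n) (𝓡 n) ∞ f) (hp : Continuous p)
    (hs : ContMDiff (𝓡 n) (𝓡 n) ∞ (f ∘ p)) : ContMDiff (𝓡 n) (𝓡 n) ∞ p := by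
  intro x
  obtain ⟨e, hxe, rfl, he⟩ := exists_inverse_of_isLocalDiffeomorph hf (p x)
  have hsymm : ContMDiffAt (𝓡 n) (𝓡 n) ∞ e.symm (e (p x)) :=
    (he _ (e.map_source hxe)).contMDiffAt (e.open_target.mem_nhds (e.map_source hxe))
  refine (hsymm.comp x hs.contMDiffAt).congr_of_eventuallyEq ?_
  filter_upwards [hp.continuousAt.preimage_mem_nhds (e.open_source.mem_nhds hxe)] with y hy
  exact (e.left_inv hy).symm

lemma Pullback.inner_mfderiv_proj {n : ℕ} {Z : Type u} {M : RiemannianMfd.{v} n}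
    [TopologicalSpace Z] {f : Z → M} (hf : IsLocalHomeomorph f) (z : Pullback hf)
    (a b : TangentSpace (𝓡 n) z) :
    inner ℝ (mfderiv (𝓡 n) (𝓡 n) (proj hf) z a) (mfderiv (𝓡 n) (𝓡 n) (proj hf) z b) =
      inner ℝ a b := by
  rw [mfderiv_proj_apply, mfderiv_proj_apply]
  rfl

section Intermediate

variable {n : ℕ} {X : RiemannianMfd.{u} n} {Y : RiemannianMfd.{v} n} {q : X → Y}

/-- A normal subgroup `K` of the covering transformations factors a regular Riemannian covering
through a regular Riemannian covering whose fibres are the orbits of `K`. -/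
theorem IsRegularRiemannianCovering.exists_factorization (hq : IsRegularRiemannianCovering q)
    {K : Subgroup (X ≃ₜ X)} (hK : K ≤ deckGroup q)
    (hnorm : ∀ g ∈ deck q, ∀ h ∈ K, g * h * g⁻¹ ∈ K) :
    ∃ (Z : RiemannianMfd.{u} n) (p : X → Z) (r : Z → Y), IsRegularRiemannianCovering p ∧
      IsRegularRiemannianCovering r ∧ r ∘ p = q ∧ ∀ x y, p x = p y ↔ ∃ g ∈ K, g y = x := by
  have hf : IsLocalHomeomorph (ofOrbit hK) := isLocalHomeomorph_ofOrbit hK hq.covering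
  let p : X → Pullback hf := toOrbit K
  let r : Pullback hf → Y := Pullback.proj hf
  have : T2Space (OrbitSpace K) := t2Space_orbitSpace hK hq.covering hq.regular
  have hpcov : IsCoveringMap p := isCoveringMap_toOrbit hK hq.covering
  have hpsurj : Function.Surjective p := surjective_toOrbit K
  have hrcov : IsCoveringMap r :=
    isCoveringMap_ofOrbit hK hq.covering hq.regular hnorm hq.surjective
  have : ConnectedSpace (OrbitSpace K) := by
    rw [connectedSpace_iff_univ, ← (surjective_toOrbit K).range_eq]
    exact isConnected_range (continuous_toOrbit K)
  have : SecondCountableTopology (OrbitSpace K) :=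
    (isQuotientMap_toOrbit K).secondCountableTopology
      (isCoveringMap_toOrbit hK hq.covering).isOpenMap
  have hrp : r ∘ p = q := rfl
  have hrd : IsLocalDiffeomorph (𝓡 n) (𝓡 n) ∞ r := Pullback.isLocalDiffeomorph_proj hf
  have hps : ContMDiff (𝓡 n) (𝓡 n) ∞ p :=
    contMDiff_of_isLocalDiffeomorph_comp hrd hpcov.continuous (hq.isometric.1)
  have hder : ∀ (x : X) (v : TangentSpace (𝓡 n) x), mfderiv (𝓡 n) (𝓡 n) q x v =
      mfderiv (𝓡 n) (𝓡 n) r (p x) (mfderiv (𝓡 n) (𝓡 n) p x v) := by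
    intro x v
    have := mfderiv_comp x (hrd.contMDiff.mdifferentiableAt (x := p x) (by simp))
      (hps.mdifferentiableAt (x := x) (by simp))
    rw [hrp] at this
    rw [this]
    rfl
  have hnm : ∀ (x : X) (v : TangentSpace (𝓡 n) x), ‖mfderiv (𝓡 n) (𝓡 n) p x v‖ₑ = ‖v‖ₑ := by
    intro x v
    rw [← hq.isometric.enorm_mfderiv x v, hder]
    exact (Pullback.enorm_mfderiv_proj hf _ _).symm
  have hpd : IsLocalDiffeomorph (𝓡 n) (𝓡 n) ∞ p := by
    refine isLocalDiffeomorph_of_injective_mfderiv hpcov.isLocalHomeomorph hps fun x v w h => ?_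
    exact hq.isometric.injective_mfderiv x (by rw [hder, hder, h])
  have : CompleteSpace (Pullback hf) := completeSpace_of_isCoveringMap hpcov hpsurj hpd hnm
  refine ⟨Pullback.toRiemannianMfd hf, p, r, ⟨hpcov, hpsurj, ⟨hps, ?_⟩, ?_⟩,
    ⟨hrcov, ?_, ⟨hrd.contMDiff, ?_⟩, ?_⟩, hrp, toOrbit_eq_iff K⟩
  · intro x a b
    rw [← hq.isometric.2 x a b, hder, hder]
    exact (Pullback.inner_mfderiv_proj hf _ _ _).symm
  · intro x y h
    obtain ⟨g, hg, rfl⟩ := (toOrbit_eq_iff K _ _).1 h.symm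
    exact ⟨g, fun z => (toOrbit_eq_iff K _ _).2 ⟨g, hg, rfl⟩, rfl⟩
  · intro y
    obtain ⟨x, rfl⟩ := hq.surjective y
    exact ⟨p x, rfl⟩
  · exact Pullback.inner_mfderiv_proj hf
  · exact fun z z' h => exists_deck_ofOrbit_of_eq hK hq.regular hnorm h

end Intermediate

/-! ### Existence of the decomposition -/

variable {n k : ℕ} {X : RiemannianMfd.{u} n} {Y : RiemannianMfd.{v} n} {q : X → Y}
  {F : Set (Set Y)}

/-- If the fibres of `p` are the orbits of the fixing group, then no covering transformation `φ` of
the second factor other than the identity fixes every foil: it lifts to a covering transformation of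
the composition that fixes every foil as well. -/
lemma eq_refl_of_fixes_foils {Z : RiemannianMfd.{u} n} {p : X → Z} {r : Z → Y}
    (hq : IsRegularRiemannianCovering q) (hr : IsRegularRiemannianCovering r) (hrp : r ∘ p = q)
    (hF : Setoid.IsPartition F) (hp : IsFoilCovering k p (lift q F) (lift r F))
    (hK : ∀ x y, p x = p y ↔ ∃ g ∈ fixingGroup q (lift q F), g y = x)
    {φ : Z ≃ₜ Z} (hφ : φ ∈ deck r) (hfix : ∀ L ∈ lift r F, φ '' L = L) :
    φ = Homeomorph.refl Z := by
  obtain ⟨x⟩ : Nonempty X := inferInstance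
  obtain ⟨y, hy⟩ := hp.covering.surjective (φ (p x))
  obtain ⟨g, hg, rfl⟩ := hq.regular x y (by
    rw [← hrp, Function.comp_apply, Function.comp_apply, hy, hφ])
  have hpc := hp.covering.covering.continuous
  have hcomm : φ ∘ p = p ∘ g := by
    refine hr.covering.eq_of_comp_eq (φ.continuous.comp hpc) (hpc.comp g.continuous)
      (funext fun z => ?_) x hy.symm
    have h1 : r (φ (p z)) = r (p z) := hφ (p z)
    have h2 : (r ∘ p) (g z) = (r ∘ p) z := by rw [hrp]; exact hg z
    exact h1.trans h2.symm
  have hgK : g ∈ fixingGroup q (lift q F) := by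
    refine ⟨hg, fun C hC => ?_⟩
    have hpart : Setoid.IsPartition (lift q F) := isPartition_lift hF
    obtain ⟨z, hz⟩ := Setoid.nonempty_of_mem_partition hpart hC
    have himage : p '' (g '' C) = p '' C := by
      rw [← Set.image_comp, ← hcomm, Set.image_comp, hfix _ (hp.maps_foils C hC)]
    -- `C` and its image have the same image under `p`, so they meet up to an element of the
    -- fixing group, which does not move `C`.
    obtain ⟨z', hz', hzz'⟩ : p z ∈ p '' (g '' C) := himage ▸ Set.mem_image_of_mem p hz
    obtain ⟨h, hh, hhz⟩ := (hK z' z).1 hzz'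
    refine eq_of_mem_partition hpart (image_mem_lift hg hC) hC hz' ?_
    rw [← hhz, ← hh.2 C hC]
    exact Set.mem_image_of_mem h hz
  refine Homeomorph.ext fun z => ?_
  obtain ⟨a, rfl⟩ := hp.covering.surjective z
  exact (congr_fun hcomm a).trans ((hK _ _).2 ⟨g, hgK, rfl⟩)

/-- The intermediate covering is the quotient by the covering transformations that fix every
foil. -/
theorem IsRegularRiemannianCovering.exists_decomposition (hq : IsRegularRiemannianCovering q)
    (hF : IsTransnormalSystem k F) :
    Nonempty (Decomposition.{u, v, u} k q (Transnormal.lift q F) F) := by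
  obtain ⟨Z, p, r, hp, hr, hrp, hK⟩ := hq.exists_factorization
    (K := fixingGroup q (Transnormal.lift q F)) (fun _ hg => hg.1)
    fun _ hg _ hh => conj_mem_fixingGroup hg hh
  have hfst : IsFoilCovering k p (Transnormal.lift q F) (Transnormal.lift r F) := by
    have h := hp.isFoilCovering (hF.lift hr)
    rwa [lift_lift hp.covering.continuous, hrp] at h
  exact ⟨{
    mid := Z
    midFoils := Transnormal.lift r F
    fst := p
    snd := r
    fst_covering := hfst
    snd_covering := hr.isFoilCovering hF
    comp_eq := hrp
    fst_fixes := fun g hg => by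
      obtain ⟨x⟩ : Nonempty X := inferInstance
      obtain ⟨h, hh, hx⟩ := (hK (g x) x).1 (hg x)
      have hgq : g ∈ deck q := fun z => by
        rw [← hrp]
        exact congrArg r (hg z)
      rw [eq_of_mem_deck hq.covering hgq hh.1 hx.symm]
      exact hh.2
    snd_effective := fun _ hφ hfix =>
      eq_refl_of_fixes_foils hq hr hrp hF.partition hfst hK hφ hfix }⟩

end Transnormal

theorem proposition3p7 {n k : ℕ}
    {Mhat : Transnormal.RiemannianMfd.{u} n} {M : Transnormal.RiemannianMfd.{v} n}
    (F : Set (Set M)) (hF : Transnormal.IsTransnormalSystem k F)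
    (q : Mhat → M) (hq : Transnormal.IsRegularRiemannianCovering q) :
    Transnormal.IsFoilCovering k q (Transnormal.lift q F) F ∧
    ∃ D : Transnormal.Decomposition.{u, v, u} k q (Transnormal.lift q F) F,
      ∀ D' : Transnormal.Decomposition.{u, v, w} k q (Transnormal.lift q F) F,
        ∃! Φ : D.mid ≃ₘ^∞⟮𝓡 n, 𝓡 n⟯ D'.mid, Transnormal.IsDecompositionIso D D' Φ := by
  obtain ⟨D⟩ := hq.exists_decomposition hF
  exact ⟨hq.isFoilCovering hF, D, fun D' => D.existsUnique_iso D'⟩
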